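/- Let $Y_1,Y_2,\dots$ be independent real random variables, all from one of the five non-Gaussian natural exponential families with quadratic variance function $V(t)=\nu_0+\nu_1t+\nu_2t^2$, where $Y_i$ has mean $\theta_i$, convolution parameter $\tau_i$ and variance $V(\theta_i)/\tau_i$. Precisely, assume that one of the following holds (for all $i\ge 1$; $O(p)$ is as $p\to\infty$; $\alpha>0$ is a constant): - Binomial: $Y_i\sim \mathrm{Bin}(n_i,p_i)/n_i$ with $n_i\in\mathbb N$, $p_i\in[0,1]$, $\tau_i=n_i$, $\theta_i=p_i$, $(\nu_0,\nu_1,\nu_2)=(0,1,-1)$; and $n_i\ge 2$ for all $i$. - Poisson: $Y_i\sim \mathrm{Poi}(\tau_i\theta_i)/\tau_i$, $(\nu_0,\nu_1,\nu_2)=(0,1,0)$; and $\inf_i\tau_i>0$, $\inf_i\tau_i\theta_i>0$, $\sum_{i=1}^p\theta_i^3=O(p)$. - Negative binomial: $Y_i\sim \mathrm{NBin}(n_i,p_i)/n_i$ with $n_i>0$, $p_i\in(0,1)$, where $\mathrm{NBin}(n,q)$ has mass $\frac{\Gamma(n+k)}{\Gamma(n)\,k!}q^k(1-q)^n$ at $k=0,1,2,\dots$;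 $\tau_i=n_i$, $\theta_i=p_i/(1-p_i)$, $(\nu_0,\nu_1,\nu_2)=(0,1,1)$; and $\inf_i n_ip_i>0$, $\sum_{i=1}^p\bigl(\frac{p_i}{1-p_i}\bigr)^4=O(p)$. - Gamma: $Y_i\sim\Gamma(\tau_i\alpha,\lambda_i)/\tau_i$ (shape $\tau_i\alpha$, scale $\lambda_i>0$), $\theta_i=\alpha\lambda_i$, $(\nu_0,\nu_1,\nu_2)=(0,0,1/\alpha)$; and $\inf_i\tau_i>0$, $\sum_{i=1}^p\lambda_i^4=O(p)$. - Generalized hyperbolic secant: $Y_i\sim \mathrm{GHS}(\tau_i\alpha,\lambda_i)/\tau_i$ with $\lambda_i\in\mathbb R$, where $\mathrm{GHS}(r,\lambda)$ has density $(1+\lambda^2)^{-r/2}e^{x\arctan\lambda}\,\frac{2^{r-2}}{\pi\Gamma(r)}\bigl|\Gamma\bigl(\frac{r+ix}{2}\bigr)\bigr|^2$ on $\mathbb R$; $\theta_i=\alpha\lambda_i$, $(\nu_0,\nu_1,\nu_2)=(\alpha,0,1/\alpha)$; and $\inf_i\tau_i>0$, $\sum_{i=1}^p\lambda_i^4=O(p)$.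 For $p\ge1$ let $\bar Y=\frac1p\sum_{i=1}^pY_i$ and, for $0\le\gamma\le\infty$, let $\hat\theta_i^{\gamma,\bar Y}=\frac{\tau_i}{\tau_i+\gamma}Y_i+\frac{\gamma}{\tau_i+\gamma}\bar Y$ ($i=1,\dots,p$), with the value $\bar Y$ at $\gamma=\infty$. Put $l_p(\boldsymbol\theta,\hat{\boldsymbol\theta})=\frac1p\sum_{i=1}^p(\hat\theta_i-\theta_i)^2$, $R_p(\boldsymbol\theta,\hat{\boldsymbol\theta})=E[l_p(\boldsymbol\theta,\hat{\boldsymbol\theta})]$, and $$\mathrm{URE}^{PG}(\gamma)=\frac1p\sum_{i=1}^p\Bigl[\frac{\gamma^2}{(\tau_i+\gamma)^2}(Y_i-\bar Y)^2+\Bigl(1-2\bigl(1-\tfrac1p\bigr)\frac{\gamma}{\tau_i+\gamma}\Bigr)\frac{V(Y_i)}{\tau_i+\nu_2}\Bigr],$$ where $\frac{\gamma}{\tau_i+\gamma}=1$ at $\gamma=\infty$. For each $p$ let the random variable $\hat\gamma^{PG}\in[0,\infty]$ be a minimizer of $\mathrm{URE}^{PG}$ over $[0,\infty]$, and let $\hat{\boldsymbol\theta}^{PG}=\hat{\boldsymbol\theta}^{\hat\gamma^{PG},\bar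 Y}$. Then for every choice, for each $p$, of a random variable $\hat\gamma\in[0,\infty]$, the risks below are finite, $$\lim_{p\to\infty}P\bigl(l_p(\boldsymbol\theta,\hat{\boldsymbol\theta}^{PG})\ge l_p(\boldsymbol\theta,\hat{\boldsymbol\theta}^{\hat\gamma,\bar Y})+\varepsilon\bigr)=0\qquad\text{for every }\varepsilon>0,$$ and $$\limsup_{p\to\infty}\bigl[R_p(\boldsymbol\theta,\hat{\boldsymbol\theta}^{PG})-R_p(\boldsymbol\theta,\hat{\boldsymbol\theta}^{\hat\gamma,\bar Y})\bigr]\le0$$ (in particular, the corresponding $\liminf$ is at most $0$). -/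

import Mathlib

open MeasureTheory ProbabilityTheory Filter
open scoped Topology ENNReal

noncomputable section

namespace GrandMeanURE

/-! ### The laws that Mathlib lacks -/

/-- The negative binomial law `NBin(n, p)` on `ℕ` with (possibly non-integer) convolution
parameter `n > 0` and mean `n * p / (1 - p)`: the mass at `k` is
`Γ(n + k) / (Γ(n) k!) * p ^ k * (1 - p) ^ n`, which is `(n + k - 1).choose k * p ^ k * (1 - p) ^ n`
for integer `n`. -/
def negBinomialMeasure (n p : ℝ) : Measure ℕ :=
  Measure.sum fun k : ℕ =>
    ENNReal.ofReal
      (Real.Gamma (n + k) / (Real.Gamma n * (k.factorial : ℝ)) * p ^ k * (1 - p) ^ n) •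
        Measure.dirac k

/-- Lebesgue density of the generalized hyperbolic secant law `GHS(r, l)`, `r > 0`, `l ∈ ℝ`:
the density `2 ^ (r - 2) / (π Γ(r)) * |Γ((r + i x) / 2)| ^ 2` (whose characteristic function is
`t ↦ sech(t) ^ r`), exponentially tilted by `exp (x * arctan l)`.
It has mean `r * l` and variance `r * (1 + l ^ 2)`. -/
def ghsDensity (r l x : ℝ) : ℝ :=
  (1 + l ^ 2) ^ (-r / 2) * Real.exp (x * Real.arctan l) *
    ((2 : ℝ) ^ (r - 2) / (Real.pi * Real.Gamma r) *
      ‖Complex.Gamma (((r : ℂ) + (x : ℂ) * Complex.I) / 2)‖ ^ 2)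

/-- The generalized hyperbolic secant law `GHS(r, l)` on `ℝ`. -/
def ghsMeasure (r l : ℝ) : Measure ℝ :=
  (volume : Measure ℝ).withDensity fun x => ENNReal.ofReal (ghsDensity r l x)

/-! ### The five non-Gaussian families with quadratic variance function -/

/-- `NEFQVFModel P Y ν₀ ν₁ ν₂ τ θ` says that, for one of the five non-Gaussian natural exponential
families with quadratic variance function `V t = ν₀ + ν₁ * t + ν₂ * t ^ 2`, every `Y i` has the
law of that family with mean `θ i` and convolution parameter `τ i` (so that the variance is
`V (θ i) / τ i`), and that the parameter sequences satisfy the regularity conditions imposed on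
that family. It says nothing about the joint law of the `Y i`. -/
inductive NEFQVFModel {Ω : Type*} [MeasurableSpace Ω] (P : Measure Ω) (Y : ℕ → Ω → ℝ) :
    (ν₀ ν₁ ν₂ : ℝ) → (τ θ : ℕ → ℝ) → Prop
  /-- `Y i ∼ Bin(n i, q i) / n i`. -/
  | binomial (n : ℕ → ℕ) (q : ℕ → unitInterval)
      (law : ∀ i, P.map (Y i) =
        (ProbabilityTheory.binomial (n i) (q i)).map (fun k : ℕ => (k : ℝ) / (n i : ℝ)))
      (two_le : ∀ i, 2 ≤ n i) :
      NEFQVFModel P Y 0 1 (-1) (fun i => (n i : ℝ)) (fun i => (q i : ℝ))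
  /-- `Y i ∼ Poi(τ i * θ i) / τ i`. -/
  | poisson (τ θ : ℕ → ℝ)
      (law : ∀ i, P.map (Y i) =
        (poissonMeasure (Real.toNNReal (τ i * θ i))).map (fun k : ℕ => (k : ℝ) / τ i))
      (inf_tau : ∃ c : ℝ, 0 < c ∧ ∀ i, c ≤ τ i)
      (inf_rate : ∃ c : ℝ, 0 < c ∧ ∀ i, c ≤ τ i * θ i)
      (moment : (fun p : ℕ => ∑ i ∈ Finset.range p, θ i ^ 3) =O[atTop] (fun p : ℕ => (p : ℝ))) :
      NEFQVFModel P Y 0 1 0 τ θ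
  /-- `Y i ∼ NBin(n i, q i) / n i`. -/
  | negBinomial (n q : ℕ → ℝ) (n_pos : ∀ i, 0 < n i) (q_mem : ∀ i, q i ∈ Set.Ioo (0 : ℝ) 1)
      (law : ∀ i, P.map (Y i) =
        (negBinomialMeasure (n i) (q i)).map (fun k : ℕ => (k : ℝ) / n i))
      (inf_rate : ∃ c : ℝ, 0 < c ∧ ∀ i, c ≤ n i * q i)
      (moment : (fun p : ℕ => ∑ i ∈ Finset.range p, (q i / (1 - q i)) ^ 4)
        =O[atTop] (fun p : ℕ => (p : ℝ))) :
      NEFQVFModel P Y 0 1 1 n (fun i => q i / (1 - q i))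
  /-- `Y i ∼ Gamma(τ i * α, lam i) / τ i` with shape `τ i * α` and scale `lam i`
  (Mathlib's `gammaMeasure` takes the rate, the inverse of the scale). -/
  | gamma (α : ℝ) (α_pos : 0 < α) (τ lam : ℕ → ℝ) (lam_pos : ∀ i, 0 < lam i)
      (law : ∀ i, P.map (Y i) =
        (gammaMeasure (τ i * α) (lam i)⁻¹).map (fun x : ℝ => x / τ i))
      (inf_tau : ∃ c : ℝ, 0 < c ∧ ∀ i, c ≤ τ i)
      (moment : (fun p : ℕ => ∑ i ∈ Finset.range p, lam i ^ 4)
        =O[atTop] (fun p : ℕ => (p : ℝ))) :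
      NEFQVFModel P Y 0 0 (1 / α) τ (fun i => α * lam i)
  /-- `Y i ∼ GHS(τ i * α, lam i) / τ i`. -/
  | ghs (α : ℝ) (α_pos : 0 < α) (τ lam : ℕ → ℝ)
      (law : ∀ i, P.map (Y i) =
        (ghsMeasure (τ i * α) (lam i)).map (fun x : ℝ => x / τ i))
      (inf_tau : ∃ c : ℝ, 0 < c ∧ ∀ i, c ≤ τ i)
      (moment : (fun p : ℕ => ∑ i ∈ Finset.range p, lam i ^ 4)
        =O[atTop] (fun p : ℕ => (p : ℝ))) :
      NEFQVFModel P Y α 0 (1 / α) τ (fun i => α * lam i)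

/-! ### Grand-mean shrinkage estimators, their loss, risk and unbiased risk estimate

The `p` observations are `y 0, …, y (p - 1)`, the first `p` terms of a sequence. -/

/-- The weight `γ / (t + γ)` of the grand mean, with its limit `1` at `γ = ∞`. -/
def shrinkWeight (t : ℝ) (γ : ℝ≥0∞) : ℝ :=
  if γ = ∞ then 1 else γ.toReal / (t + γ.toReal)

/-- The grand mean of the first `p` observations. -/
def grandMean (p : ℕ) (y : ℕ → ℝ) : ℝ :=
  (∑ i ∈ Finset.range p, y i) / (p : ℝ)

/-- The grand-mean shrinkage estimate of the `i`-th mean,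
`τ i / (τ i + γ) * y i + γ / (τ i + γ) * ȳ`. -/
def grandMeanEstimate (τ : ℕ → ℝ) (p : ℕ) (γ : ℝ≥0∞) (y : ℕ → ℝ) (i : ℕ) : ℝ :=
  (1 - shrinkWeight (τ i) γ) * y i + shrinkWeight (τ i) γ * grandMean p y

/-- The averaged squared-error loss of an estimate `est` of `θ`. -/
def loss (p : ℕ) (θ est : ℕ → ℝ) : ℝ :=
  (1 / (p : ℝ)) * ∑ i ∈ Finset.range p, (est i - θ i) ^ 2

/-- The loss, as a random variable, of the grand-mean shrinkage estimator with the (data-dependent)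
shrinkage parameter `g`. -/
def grandMeanLoss {Ω : Type*} (Y : ℕ → Ω → ℝ) (τ θ : ℕ → ℝ) (p : ℕ) (g : Ω → ℝ≥0∞) (ω : Ω) : ℝ :=
  loss p θ (grandMeanEstimate τ p (g ω) (fun i => Y i ω))

/-- The risk (expected loss) of the grand-mean shrinkage estimator with parameter `g`. -/
def grandMeanRisk {Ω : Type*} [MeasurableSpace Ω] (P : Measure Ω) (Y : ℕ → Ω → ℝ)
    (τ θ : ℕ → ℝ) (p : ℕ) (g : Ω → ℝ≥0∞) : ℝ :=
  ∫ ω, grandMeanLoss Y τ θ p g ω ∂P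

/-- The unbiased estimate of the risk of the grand-mean shrinkage estimator with fixed `γ`. -/
def urePG (ν₀ ν₁ ν₂ : ℝ) (τ : ℕ → ℝ) (p : ℕ) (y : ℕ → ℝ) (γ : ℝ≥0∞) : ℝ :=
  (1 / (p : ℝ)) * ∑ i ∈ Finset.range p,
    (shrinkWeight (τ i) γ ^ 2 * (y i - grandMean p y) ^ 2 +
      (1 - 2 * (1 - 1 / (p : ℝ)) * shrinkWeight (τ i) γ) *
        ((ν₀ + ν₁ * y i + ν₂ * y i ^ 2) / (τ i + ν₂)))

end GrandMeanURE

end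

/-! Write `w i = γ / (τ i + γ)`, let `V̂ i = V(Y i) / (τ i + ν₂)` be the unbiased estimate of the
variance of `Y i`, and let `D i = (Y i - θ i) * Y i - V̂ i`, which has mean 0. Expanding the squares
(`urePG_sub_loss`), the risk estimate minus the loss equals a term free of `γ` plus `(2/p) ∑ w i D i
- (2/p) Ȳ ∑ w i (Y i - θ i) + (2/p²) ∑ w i V̂ i`. The free term cancels when two values of `γ` are
compared, so it need not be small. The other three must be small uniformly in `γ`, since `γ` may
depend on the data.

Uniformity comes from monotonicity. Once the indices are sorted by `τ`, the weights decrease and lie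
in `[0, 1]` for every `γ` at once, so Abel summation bounds a weighted sum by the largest partial
sum, in which `γ` no longer occurs. A crude maximal inequality is enough: the partial sums are
inspected at every `b`-th index and Cauchy–Schwarz covers the gaps. With `b ≈ √p` the square of the
maximum has mean `O(p^(3/2))` (`exists_uniform_bound`). Dividing by `p`, and separating the factor
`Ȳ` by a weighted AM-GM inequality, leaves an integrable bound `B` with mean `O(p^(-1/4))`
(`MomentControl.exists_bound`). Minimality of the risk estimate then bounds the difference of losses
by `2 B`; Markov's inequality gives the statement in probability, integration the one on risks.

It remains to verify `MomentControl` for each family: the second moments of `Y i` and `D i` are at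
most `v i`, with `∑ v i = O(p)`. As `D i` is quadratic in `Y i`, this takes four moments.
Boundedness suffices for the binomial law; a recursion of the weights serves the Poisson and
negative binomial laws, a shift of the shape the gamma law. For the hyperbolic secant law, the
moment generating function is found by Mellin inversion and then differentiated. -/

namespace GrandMeanURE

/-! ### Weighted sums and partial sums -/

/-- Abel summation: a weighted sum with antitone weights in `[0, 1]` is bounded by the largest
partial sum. -/
lemma abs_sum_mul_le_of_antitone {w z : ℕ → ℝ} {n : ℕ} {M : ℝ}
    (hw0 : ∀ i < n, 0 ≤ w i) (hw1 : ∀ i < n, w i ≤ 1)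
    (hw : ∀ i, i + 1 < n → w (i + 1) ≤ w i)
    (hM : ∀ j ≤ n, |∑ i ∈ Finset.range j, z i| ≤ M) :
    |∑ i ∈ Finset.range n, w i * z i| ≤ M := by
  -- Replacing all weights up to `m` by the last one, `w m`, costs at most the total drop `w 0 - w
  -- m` times `M`. Adding the term with `w m` back gives `w 0 * M ≤ M`.
  have key : ∀ m, m < n →
      |∑ i ∈ Finset.range (m + 1), w i * z i - w m * ∑ i ∈ Finset.range (m + 1), z i| ≤
        (w 0 - w m) * M := by
    intro m
    induction m with
    | zero => intro _; simp
    | succ m ih =>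
      intro hm
      have h1 := ih (by omega)
      have h2 := hM (m + 1) (by omega)
      have h3 : ∑ i ∈ Finset.range (m + 1 + 1), w i * z i
          - w (m + 1) * ∑ i ∈ Finset.range (m + 1 + 1), z i =
          (∑ i ∈ Finset.range (m + 1), w i * z i - w m * ∑ i ∈ Finset.range (m + 1), z i) +
            (w m - w (m + 1)) * ∑ i ∈ Finset.range (m + 1), z i := by
        rw [Finset.sum_range_succ _ (m + 1), Finset.sum_range_succ _ (m + 1)]; ring
      rw [h3]
      refine (abs_add_le _ _).trans ?_
      rw [abs_mul, abs_of_nonneg (sub_nonneg.2 (hw m hm))]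
      have h4 := mul_le_mul_of_nonneg_left h2 (sub_nonneg.2 (hw m hm))
      linarith
  have hM0 : 0 ≤ M := (abs_nonneg _).trans (hM 0 (Nat.zero_le _))
  rcases n with _ | m
  · simpa using hM0
  · have h1 := key m (by omega)
    have h2 := hM (m + 1) le_rfl
    have h3 : ∑ i ∈ Finset.range (m + 1), w i * z i =
        (∑ i ∈ Finset.range (m + 1), w i * z i - w m * ∑ i ∈ Finset.range (m + 1), z i) +
          w m * ∑ i ∈ Finset.range (m + 1), z i := by ring
    rw [h3]
    refine (abs_add_le _ _).trans ?_
    rw [abs_mul, abs_of_nonneg (hw0 m (by omega))]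
    have h4 := mul_le_mul_of_nonneg_left h2 (hw0 m (by omega))
    have h5 := mul_le_mul_of_nonneg_right (hw1 0 (by omega)) hM0
    linarith

/-- All partial sums are controlled by those at the multiples of `b` and by the sum of squares. -/
lemma sq_partial_sum_le (z : ℕ → ℝ) {n b j : ℕ} (hb : 0 < b) (hj : j ≤ n) :
    (∑ i ∈ Finset.range j, z i) ^ 2 ≤
      2 * ∑ k ∈ Finset.range (n / b + 1), (∑ i ∈ Finset.range (b * k), z i) ^ 2 +
        2 * b * ∑ i ∈ Finset.range n, z i ^ 2 := by
  -- Cut at the last multiple of `b` up to `j`: the head is one of the squares summed over `k`, and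
  -- the tail has fewer than `b` terms, so Cauchy–Schwarz applies.
  have hle : b * (j / b) ≤ j := Nat.mul_div_le j b
  have hsplit := Finset.sum_range_add_sum_Ico z hle
  have h1 : (∑ i ∈ Finset.range (b * (j / b)), z i) ^ 2 ≤
      ∑ k ∈ Finset.range (n / b + 1), (∑ i ∈ Finset.range (b * k), z i) ^ 2 :=
    Finset.single_le_sum (f := fun k => (∑ i ∈ Finset.range (b * k), z i) ^ 2)
      (fun _ _ => sq_nonneg _)
      (Finset.mem_range.2 (Nat.lt_succ_of_le (Nat.div_le_div_right hj)))
  have h2 : (∑ i ∈ Finset.Ico (b * (j / b)) j, z i) ^ 2 ≤ b * ∑ i ∈ Finset.range n, z i ^ 2 := by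
    refine sq_sum_le_card_mul_sum_sq.trans ?_
    have hc : (Finset.Ico (b * (j / b)) j).card ≤ b := by
      rw [Nat.card_Ico]
      have := Nat.mod_lt j hb
      have := Nat.div_add_mod j b
      omega
    refine mul_le_mul (by exact_mod_cast hc) ?_ (Finset.sum_nonneg fun _ _ => sq_nonneg _)
      (Nat.cast_nonneg _)
    refine Finset.sum_le_sum_of_subset_of_nonneg ?_ (fun _ _ _ => sq_nonneg _)
    intro i hi
    rw [Finset.mem_Ico] at hi
    exact Finset.mem_range.2 (by omega)
  rw [← hsplit]
  have := add_sq_le (a := ∑ i ∈ Finset.range (b * (j / b)), z i)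
    (b := ∑ i ∈ Finset.Ico (b * (j / b)) j, z i)
  linarith

/-- The first `p` indices can be rearranged so that a given sequence becomes monotone. -/
lemma exists_sorting (τ : ℕ → ℝ) (p : ℕ) : ∃ e : ℕ → ℕ,
    (∀ i j, i ≤ j → j < p → τ (e i) ≤ τ (e j)) ∧ (∀ i < p, e i < p) ∧
      (∀ i < p, ∀ j < p, e i = e j → i = j) ∧
      ∀ f : ℕ → ℝ, ∑ i ∈ Finset.range p, f (e i) = ∑ i ∈ Finset.range p, f i := by
  let t : Fin p → ℝ := fun i => τ i
  let s := Tuple.sort t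
  -- Beyond `p` the identity is a filler value that none of the clauses inspects.
  refine ⟨fun i => if h : i < p then (s ⟨i, h⟩ : ℕ) else i, ?_, ?_, ?_, ?_⟩
  · intro i j hij hj
    have hi : i < p := hij.trans_lt hj
    simp only [hi, hj, dif_pos]
    exact Tuple.monotone_sort t (show (⟨i, hi⟩ : Fin p) ≤ ⟨j, hj⟩ from hij)
  · intro i hi
    simp [hi]
  · intro i hi j hj h
    simp only [hi, hj, dif_pos] at h
    have := s.injective (Fin.ext h)
    simpa using this
  · intro f
    rw [Finset.sum_range, Finset.sum_range]
    simp only [Fin.is_lt, dif_pos, Fin.eta]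
    exact Equiv.sum_comp s (fun i : Fin p => f i)

/-! ### The shrinkage weights -/

lemma shrinkWeight_nonneg {t : ℝ} (ht : 0 < t) (g : ℝ≥0∞) : 0 ≤ shrinkWeight t g := by
  unfold shrinkWeight
  split_ifs
  · exact zero_le_one
  · positivity

lemma shrinkWeight_le_one {t : ℝ} (ht : 0 < t) (g : ℝ≥0∞) : shrinkWeight t g ≤ 1 := by
  unfold shrinkWeight
  split_ifs
  · exact le_rfl
  · exact div_le_one_of_le₀ (by linarith) (by positivity)

lemma shrinkWeight_anti {s t : ℝ} (hs : 0 < s) (hst : s ≤ t) (g : ℝ≥0∞) :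
    shrinkWeight t g ≤ shrinkWeight s g := by
  unfold shrinkWeight
  split_ifs
  · exact le_rfl
  · exact div_le_div_of_nonneg_left (by positivity) (by positivity) (by linarith)

lemma measurable_shrinkWeight (t : ℝ) : Measurable (shrinkWeight t) := by
  unfold shrinkWeight
  refine Measurable.ite (measurableSet_singleton _) measurable_const ?_
  fun_prop

/-- A weighted sum with shrinkage weights is controlled, uniformly in the shrinkage parameter, by
partial sums along an order that sorts the `τ i`. -/
lemma sq_sum_shrinkWeight_le {τ : ℕ → ℝ} (hτ : ∀ i, 0 < τ i) {p b : ℕ} (hb : 0 < b) {e : ℕ → ℕ}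
    (he : ∀ i j, i ≤ j → j < p → τ (e i) ≤ τ (e j))
    (hsum : ∀ f : ℕ → ℝ, ∑ i ∈ Finset.range p, f (e i) = ∑ i ∈ Finset.range p, f i)
    (x : ℕ → ℝ) (g : ℝ≥0∞) :
    (∑ i ∈ Finset.range p, shrinkWeight (τ i) g * x i) ^ 2 ≤
      2 * ∑ k ∈ Finset.range (p / b + 1), (∑ i ∈ Finset.range (b * k), x (e i)) ^ 2 +
        2 * b * ∑ i ∈ Finset.range p, x i ^ 2 := by
  set G := 2 * ∑ k ∈ Finset.range (p / b + 1), (∑ i ∈ Finset.range (b * k), x (e i)) ^ 2 +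
        2 * b * ∑ i ∈ Finset.range p, x i ^ 2 with hG
  have hG0 : 0 ≤ G := by positivity
  rw [← hsum (fun i => shrinkWeight (τ i) g * x i)]
  have h := abs_sum_mul_le_of_antitone (w := fun i => shrinkWeight (τ (e i)) g)
    (z := fun i => x (e i)) (n := p) (M := √G)
    (fun i _ => shrinkWeight_nonneg (hτ _) g) (fun i _ => shrinkWeight_le_one (hτ _) g)
    (fun i hi => shrinkWeight_anti (hτ _) (he i (i + 1) (by omega) hi) g)
    (fun j hj => by
      refine Real.abs_le_sqrt ((sq_partial_sum_le (fun i => x (e i)) hb hj).trans ?_)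
      rw [hsum (fun i => x i ^ 2)])
  calc _ ≤ (√G) ^ 2 := sq_le_sq' (abs_le.1 h).1 (abs_le.1 h).2
    _ = G := Real.sq_sqrt hG0

/-! ### Second-moment bounds uniform in the shrinkage parameter -/

variable {Ω : Type*} [MeasurableSpace Ω] {P : Measure Ω} [IsProbabilityMeasure P]

/-- The second moment of a sum of independent centered variables, along an injective
reindexing. -/
lemma integral_sq_sum_of_iIndepFun {X : ℕ → Ω → ℝ} (hX : iIndepFun X P)
    (hL2 : ∀ i, MemLp (X i) 2 P) (h0 : ∀ i, ∫ ω, X i ω ∂P = 0) {e : ℕ → ℕ} {m : ℕ}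
    (he : ∀ i < m, ∀ j < m, e i = e j → i = j) :
    ∫ ω, (∑ i ∈ Finset.range m, X (e i) ω) ^ 2 ∂P =
      ∑ i ∈ Finset.range m, ∫ ω, X (e i) ω ^ 2 ∂P := by
  have hv : ∀ i, Var[X i; P] = ∫ ω, X i ω ^ 2 ∂P := fun i =>
    variance_of_integral_eq_zero (hL2 i).aemeasurable (h0 i)
  have hs := IndepFun.variance_sum (X := fun i => X (e i)) (s := Finset.range m)
    (fun i _ => hL2 (e i)) (fun i hi j hj hij => hX.indepFun fun h =>
      hij (he i (by simpa using hi) j (by simpa using hj) h))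
  have hm : MemLp (∑ i ∈ Finset.range m, X (e i)) 2 P := memLp_finsetSum' _ fun i _ => hL2 (e i)
  rw [variance_of_integral_eq_zero hm.aemeasurable] at hs
  · simp only [hv, Finset.sum_apply] at hs
    exact hs
  · simp only [Finset.sum_apply]
    rw [integral_finsetSum _ fun i _ => (hL2 (e i)).integrable one_le_two]
    simp [h0]

/-- Independent centered variables: sums weighted with shrinkage weights are bounded, uniformly
in the shrinkage parameter, with only a loss of a factor `√p`. -/
lemma exists_uniform_bound {τ : ℕ → ℝ} (hτ : ∀ i, 0 < τ i) {X : ℕ → Ω → ℝ} (hX : iIndepFun X P)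
    (hL2 : ∀ i, MemLp (X i) 2 P) (h0 : ∀ i, ∫ ω, X i ω ∂P = 0) {v : ℕ → ℝ}
    (hv : ∀ i, ∫ ω, X i ω ^ 2 ∂P ≤ v i) (p : ℕ) :
    ∃ G : Ω → ℝ, Integrable G P ∧
      (∀ ω g, (∑ i ∈ Finset.range p, shrinkWeight (τ i) g * X i ω) ^ 2 ≤ G ω) ∧
      ∫ ω, G ω ∂P ≤ 4 * (√p + 1) * ∑ i ∈ Finset.range p, v i := by
  obtain ⟨e, he, hlt, hinj, hsum⟩ := exists_sorting τ p
  -- This choice balances the number `p / b + 1` of inspected partial sums against the gap length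
  -- `b`. The `+ 1` gives `p < b * b`, hence `p / b + 1 ≤ b`; each of the two parts then contributes
  -- `2 * b * ∑ v i`.
  set b := Nat.sqrt p + 1 with hb
  have hb0 : 0 < b := Nat.succ_pos _
  have hv0 : ∀ i, 0 ≤ v i := fun i => (integral_nonneg fun ω => sq_nonneg _).trans (hv i)
  have hsq : ∀ i, Integrable (fun ω => X i ω ^ 2) P := fun i => (hL2 i).integrable_sq
  have hSsq : ∀ m, Integrable (fun ω => (∑ i ∈ Finset.range m, X (e i) ω) ^ 2) P := fun m =>
    (memLp_finsetSum _ fun i _ => hL2 (e i)).integrable_sq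
  have hS : ∀ m ≤ p, ∫ ω, (∑ i ∈ Finset.range m, X (e i) ω) ^ 2 ∂P ≤
      ∑ i ∈ Finset.range p, v i := by
    intro m hm
    rw [integral_sq_sum_of_iIndepFun hX hL2 h0 fun i hi j hj =>
      hinj i (hi.trans_le hm) j (hj.trans_le hm), ← hsum v]
    refine (Finset.sum_le_sum fun i _ => hv (e i)).trans ?_
    exact Finset.sum_le_sum_of_subset_of_nonneg (Finset.range_mono hm) fun _ _ _ => hv0 _
  have hI1 : Integrable (fun ω => ∑ k ∈ Finset.range (p / b + 1),
      (∑ i ∈ Finset.range (b * k), X (e i) ω) ^ 2) P := integrable_finsetSum _ fun k _ => hSsq _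
  have hI2 : Integrable (fun ω => ∑ i ∈ Finset.range p, X i ω ^ 2) P :=
    integrable_finsetSum _ fun i _ => hsq i
  refine ⟨fun ω => 2 * ∑ k ∈ Finset.range (p / b + 1),
      (∑ i ∈ Finset.range (b * k), X (e i) ω) ^ 2 + 2 * b * ∑ i ∈ Finset.range p, X i ω ^ 2,
    (hI1.const_mul 2).add (hI2.const_mul _), fun ω g =>
      sq_sum_shrinkWeight_le hτ hb0 he hsum (fun i => X i ω) g, ?_⟩
  rw [integral_add (hI1.const_mul 2) (hI2.const_mul _), integral_const_mul, integral_const_mul,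
    integral_finsetSum _ fun k _ => hSsq _, integral_finsetSum _ fun i _ => hsq i]
  have hV : 0 ≤ ∑ i ∈ Finset.range p, v i := Finset.sum_nonneg fun i _ => hv0 i
  have hcount : p / b + 1 ≤ b :=
    Nat.div_lt_of_lt_mul (by rw [hb]; exact Nat.lt_succ_sqrt p)
  have h1 : ∑ k ∈ Finset.range (p / b + 1), ∫ ω, (∑ i ∈ Finset.range (b * k), X (e i) ω) ^ 2 ∂P ≤
      b * ∑ i ∈ Finset.range p, v i := by
    refine (Finset.sum_le_card_nsmul _ _ _ fun k hk => hS (b * k) ?_).trans ?_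
    · have : k ≤ p / b := Nat.lt_succ_iff.1 (Finset.mem_range.1 hk)
      exact (Nat.mul_le_mul_left b this).trans (Nat.mul_div_le p b)
    · rw [Finset.card_range, nsmul_eq_mul]
      exact mul_le_mul_of_nonneg_right (by exact_mod_cast hcount) hV
  have h2 : ∑ i ∈ Finset.range p, ∫ ω, X i ω ^ 2 ∂P ≤ ∑ i ∈ Finset.range p, v i :=
    Finset.sum_le_sum fun i _ => hv i
  have hb1 : (b : ℝ) ≤ √p + 1 := by
    rw [hb]; push_cast
    gcongr
    exact Real.nat_sqrt_le_real_sqrt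
  have h3 := mul_le_mul_of_nonneg_left h2 (Nat.cast_nonneg (α := ℝ) b)
  have h4 := mul_le_mul_of_nonneg_right hb1 hV
  nlinarith

/-! ### The estimation error of the risk estimate -/

/-- The unbiased estimate of the variance of an observation `y`. -/
noncomputable def varEstimate (ν₀ ν₁ ν₂ t y : ℝ) : ℝ := (ν₀ + ν₁ * y + ν₂ * y ^ 2) / (t + ν₂)

/-- An unbiased estimate of `0`: the difference of the estimates `(y - θ) * y` and
`varEstimate` of the variance. -/
noncomputable def varDiscrepancy (ν₀ ν₁ ν₂ t m y : ℝ) : ℝ := (y - m) * y - varEstimate ν₀ ν₁ ν₂ t y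

/-- The error of the estimate is `(y i - θ i) - w * (y i - ȳ)`, so the terms quadratic in `w`
cancel. Only the first sum is free of `g`; the last one stems from the `1 / p` in the factor `1 - 1
/ p`. -/
lemma urePG_sub_loss (ν₀ ν₁ ν₂ : ℝ) (τ θ y : ℕ → ℝ) (p : ℕ) (g : ℝ≥0∞) :
    urePG ν₀ ν₁ ν₂ τ p y g - loss p θ (grandMeanEstimate τ p g y) =
      1 / p * ∑ i ∈ Finset.range p, (varEstimate ν₀ ν₁ ν₂ (τ i) (y i) - (y i - θ i) ^ 2) +
      (2 / p * ∑ i ∈ Finset.range p,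
          shrinkWeight (τ i) g * varDiscrepancy ν₀ ν₁ ν₂ (τ i) (θ i) (y i) -
        2 / p * (grandMean p y * ∑ i ∈ Finset.range p, shrinkWeight (τ i) g * (y i - θ i)) +
        2 / p ^ 2 * ∑ i ∈ Finset.range p,
          shrinkWeight (τ i) g * varEstimate ν₀ ν₁ ν₂ (τ i) (y i)) := by
  unfold urePG loss grandMeanEstimate
  rw [← mul_sub, ← Finset.sum_sub_distrib]
  simp only [Finset.mul_sum]
  rw [← Finset.sum_sub_distrib, ← Finset.sum_add_distrib, ← Finset.sum_add_distrib]
  refine Finset.sum_congr rfl fun i _ => ?_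
  unfold varDiscrepancy varEstimate
  generalize shrinkWeight (τ i) g = w
  generalize grandMean p y = a
  ring

lemma sq_grandMean_le (p : ℕ) (y : ℕ → ℝ) :
    grandMean p y ^ 2 ≤ 1 / p * ∑ i ∈ Finset.range p, y i ^ 2 := by
  rcases Nat.eq_zero_or_pos p with rfl | hp
  · simp [grandMean]
  have hp' : (0 : ℝ) < p := by exact_mod_cast hp
  have h := sq_sum_le_card_mul_sum_sq (s := Finset.range p) (f := y)
  rw [Finset.card_range] at h
  unfold grandMean
  rw [div_pow, div_le_iff₀ (by positivity)]
  calc _ ≤ _ := h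
    _ = _ := by field_simp

/-- The moment properties of the observations from which the asymptotic optimality follows. -/
structure MomentControl (P : Measure Ω) (Y : ℕ → Ω → ℝ) (ν₀ ν₁ ν₂ : ℝ) (τ θ v : ℕ → ℝ) :
    Prop where
  tau_pos : ∀ i, 0 < τ i
  memLp : ∀ i, MemLp (Y i) 2 P
  memLp_discrepancy : ∀ i, MemLp (fun ω => varDiscrepancy ν₀ ν₁ ν₂ (τ i) (θ i) (Y i ω)) 2 P
  mean : ∀ i, ∫ ω, Y i ω ∂P = θ i
  mean_discrepancy : ∀ i, ∫ ω, varDiscrepancy ν₀ ν₁ ν₂ (τ i) (θ i) (Y i ω) ∂P = 0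
  sq_le : ∀ i, ∫ ω, Y i ω ^ 2 ∂P ≤ v i
  sq_discrepancy_le : ∀ i, ∫ ω, varDiscrepancy ν₀ ν₁ ν₂ (τ i) (θ i) (Y i ω) ^ 2 ∂P ≤ v i

/-- Weighted AM-GM: it separates a factor `B` of bounded second moment, later `1` or the grand mean,
from the weighted sum `A`, so that no independence between the two is needed. -/
lemma mul_abs_div_le {A B G δ q : ℝ} (hδ : 0 < δ) (hq : 0 < q) (hB : A ^ 2 ≤ G) :
    2 / q * |B * A| ≤ δ * B ^ 2 + G / (δ * q ^ 2) := by
  have h1 : 2 * (δ * |B|) * (|A| / q) ≤ (δ * |B|) ^ 2 + (|A| / q) ^ 2 := two_mul_le_add_sq _ _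
  have h2 : (δ * |B|) ^ 2 + (|A| / q) ^ 2 ≤ δ * (δ * B ^ 2 + G / (δ * q ^ 2)) := by
    have : δ * (δ * B ^ 2 + G / (δ * q ^ 2)) = δ ^ 2 * B ^ 2 + G / q ^ 2 := by
      field_simp
    rw [this, mul_pow, sq_abs, div_pow, sq_abs]
    gcongr
  have h3 : 2 * (δ * |B|) * (|A| / q) = δ * (2 / q * |B * A|) := by
    rw [abs_mul]; ring
  rw [h3] at h1
  exact le_of_mul_le_mul_left (h1.trans h2) hδ

/-- Up to a term that does not depend on the shrinkage parameter, the risk estimate is uniformly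
close to the loss. -/
lemma MomentControl.exists_bound {Y : ℕ → Ω → ℝ} {ν₀ ν₁ ν₂ : ℝ} {τ θ v : ℕ → ℝ}
    (h : MomentControl P Y ν₀ ν₁ ν₂ τ θ v) (hY : iIndepFun Y P) {p : ℕ} (hp : 0 < p) {K : ℝ}
    (hK : ∑ i ∈ Finset.range p, v i ≤ K * p) :
    ∃ B : Ω → ℝ, Integrable B P ∧ (∀ ω, ∃ c : ℝ, ∀ g,
        |urePG ν₀ ν₁ ν₂ τ p (fun i => Y i ω) g -
          loss p θ (grandMeanEstimate τ p g (fun i => Y i ω)) - c| ≤ B ω) ∧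
      ∫ ω, B ω ∂P ≤ (3 + 21 * K) / √√p := by
  have hp' : (0 : ℝ) < p := by exact_mod_cast hp
  have hv0 : ∀ i, 0 ≤ v i := fun i => (integral_nonneg fun ω => sq_nonneg _).trans (h.sq_le i)
  have hK0 : 0 ≤ K := by
    have : 0 ≤ K * p := (Finset.sum_nonneg fun i _ => hv0 i).trans hK
    exact nonneg_of_mul_nonneg_left this hp'
  have hmeasD : ∀ i, Measurable (varDiscrepancy ν₀ ν₁ ν₂ (τ i) (θ i)) := fun i => by
    unfold varDiscrepancy varEstimate; fun_prop
  have hcL2 : ∀ i, MemLp (fun ω => Y i ω - θ i) 2 P := fun i => (h.memLp i).sub (memLp_const _)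
  have hcsq : ∀ i, ∫ ω, (Y i ω - θ i) ^ 2 ∂P ≤ v i := by
    intro i
    have h1 : ∫ ω, (Y i ω - θ i) ^ 2 ∂P = Var[Y i; P] := by
      rw [variance_eq_integral (h.memLp i).aemeasurable, h.mean i]
    rw [h1, variance_eq_sub (h.memLp i)]
    have := h.sq_le i
    have h2 := sq_nonneg (∫ ω, Y i ω ∂P)
    simp only [Pi.pow_apply]
    linarith
  obtain ⟨G₁, hG₁, hle₁, hE₁⟩ := exists_uniform_bound h.tau_pos
    (hY.comp (fun i => varDiscrepancy ν₀ ν₁ ν₂ (τ i) (θ i)) hmeasD) h.memLp_discrepancy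
    h.mean_discrepancy h.sq_discrepancy_le p
  obtain ⟨G₂, hG₂, hle₂, hE₂⟩ := exists_uniform_bound h.tau_pos
    (hY.comp (fun i y => y - θ i) fun i => by fun_prop) hcL2
    (fun i => by
      simp only [Function.comp_apply]
      rw [integral_sub ((h.memLp i).integrable one_le_two) (integrable_const _), h.mean i]
      simp) hcsq p
  simp only [Function.comp_apply] at hle₁ hle₂
  set x := √√p with hx
  have hx1 : 1 ≤ x := by
    rw [hx]
    refine Real.one_le_sqrt.2 (Real.one_le_sqrt.2 ?_)
    exact_mod_cast hp
  have hx0 : 0 < x := zero_lt_one.trans_le hx1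
  have hx2 : √(p : ℝ) = x ^ 2 := (Real.sq_sqrt (Real.sqrt_nonneg _)).symm
  have hx4 : (p : ℝ) = x ^ 4 := by
    rw [show x ^ 4 = (x ^ 2) ^ 2 by ring, ← hx2, Real.sq_sqrt hp'.le]
  have hsqI : ∀ i, Integrable (fun ω => Y i ω ^ 2) P := fun i => (h.memLp i).integrable_sq
  have hcsqI : ∀ i, Integrable (fun ω => (Y i ω - θ i) ^ 2) P := fun i => (hcL2 i).integrable_sq
  have hdsqI : ∀ i, Integrable
      (fun ω => varDiscrepancy ν₀ ν₁ ν₂ (τ i) (θ i) (Y i ω) ^ 2) P :=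
    fun i => (h.memLp_discrepancy i).integrable_sq
  -- An integrable majorant of the variance estimate, obtained by AM-GM from `V̂ = (Y - θ) * Y - D`;
  -- hence no separate moment condition on `V̂` is required.
  let U : ℕ → Ω → ℝ := fun i ω => ((Y i ω - θ i) ^ 2 + Y i ω ^ 2) / 2 +
    (1 + varDiscrepancy ν₀ ν₁ ν₂ (τ i) (θ i) (Y i ω) ^ 2) / 2
  have hUI1 : ∀ i, Integrable (fun ω => ((Y i ω - θ i) ^ 2 + Y i ω ^ 2) / 2) P := fun i =>
    ((hcsqI i).add (hsqI i)).div_const 2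
  have hUI2 : ∀ i, Integrable
      (fun ω => (1 + varDiscrepancy ν₀ ν₁ ν₂ (τ i) (θ i) (Y i ω) ^ 2) / 2) P := fun i =>
    ((integrable_const 1).add (hdsqI i)).div_const 2
  have hUI : ∀ i, Integrable (U i) P := fun i => (hUI1 i).add (hUI2 i)
  have hU : ∀ i ω, |varEstimate ν₀ ν₁ ν₂ (τ i) (Y i ω)| ≤ U i ω := by
    intro i ω
    have h1 : varEstimate ν₀ ν₁ ν₂ (τ i) (Y i ω) =
      (Y i ω - θ i) * Y i ω - varDiscrepancy ν₀ ν₁ ν₂ (τ i) (θ i) (Y i ω) := by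
      unfold varDiscrepancy; ring
    rw [h1, abs_le]
    simp only [U]
    generalize varDiscrepancy ν₀ ν₁ ν₂ (τ i) (θ i) (Y i ω) = d
    constructor <;> nlinarith [sq_nonneg (Y i ω - θ i - Y i ω), sq_nonneg (Y i ω - θ i + Y i ω),
      sq_nonneg (1 - d), sq_nonneg (1 + d)]
  have hUE : ∀ i, ∫ ω, U i ω ∂P ≤ 2 * v i + 1 := by
    intro i
    simp only [U]
    rw [integral_add (hUI1 i) (hUI2 i), integral_div, integral_div,
      integral_add (hcsqI i) (hsqI i), integral_add (integrable_const 1) (hdsqI i)]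
    have := hcsq i
    have := h.sq_le i
    have := h.sq_discrepancy_le i
    have := hv0 i
    simp only [integral_const, probReal_univ, smul_eq_mul, mul_one]
    linarith
  -- With `x = p^(1/4)` one has `∫ G ≤ 8 * K * x^6`, so `G / (δ * p^2)` has mean at most `8 * K /
  -- x`, of the same order as `δ`. In units of `1 / x` the three error terms contribute `1 + 8 * K`,
  -- `K + 8 * K` and `2 + 4 * K`, in total `3 + 21 * K`.
  set δ := 1 / x with hδ
  have hδ0 : 0 < δ := by positivity
  have hI1 : Integrable (fun ω => δ * 1 ^ 2 + G₁ ω / (δ * (p : ℝ) ^ 2)) P :=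
    (integrable_const _).add (hG₁.div_const _)
  have hI2 : Integrable (fun ω => δ * (1 / p * ∑ i ∈ Finset.range p, Y i ω ^ 2)) P :=
    ((integrable_finsetSum _ fun i _ => hsqI i).const_mul _).const_mul _
  have hI3 : Integrable (fun ω => G₂ ω / (δ * (p : ℝ) ^ 2)) P := hG₂.div_const _
  have hI4 : Integrable (fun ω => 2 / (p : ℝ) ^ 2 * ∑ i ∈ Finset.range p, U i ω) P :=
    (integrable_finsetSum _ fun i _ => hUI i).const_mul _
  have hI23 : Integrable (fun ω => δ * (1 / p * ∑ i ∈ Finset.range p, Y i ω ^ 2) +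
      G₂ ω / (δ * (p : ℝ) ^ 2)) P := hI2.add hI3
  have hI123 : Integrable (fun ω => (δ * 1 ^ 2 + G₁ ω / (δ * (p : ℝ) ^ 2)) +
      (δ * (1 / p * ∑ i ∈ Finset.range p, Y i ω ^ 2) + G₂ ω / (δ * (p : ℝ) ^ 2))) P :=
    hI1.add hI23
  refine ⟨fun ω => (δ * 1 ^ 2 + G₁ ω / (δ * (p : ℝ) ^ 2)) +
      (δ * (1 / p * ∑ i ∈ Finset.range p, Y i ω ^ 2) + G₂ ω / (δ * (p : ℝ) ^ 2)) +
      2 / (p : ℝ) ^ 2 * ∑ i ∈ Finset.range p, U i ω,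
    hI123.add hI4, ?_, ?_⟩
  · intro ω
    refine ⟨1 / p * ∑ i ∈ Finset.range p,
      (varEstimate ν₀ ν₁ ν₂ (τ i) (Y i ω) - (Y i ω - θ i) ^ 2), fun g => ?_⟩
    rw [urePG_sub_loss, add_sub_cancel_left]
    refine (abs_add_le _ _).trans (add_le_add ((abs_sub _ _).trans (add_le_add ?_ ?_)) ?_)
    · rw [abs_mul, abs_of_nonneg (by positivity : (0 : ℝ) ≤ 2 / p)]
      have := mul_abs_div_le (B := 1) hδ0 hp' (hle₁ ω g)
      rwa [one_mul] at this
    · rw [abs_mul, abs_of_nonneg (by positivity : (0 : ℝ) ≤ 2 / p)]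
      refine (mul_abs_div_le hδ0 hp' (hle₂ ω g)).trans ?_
      gcongr
      exact sq_grandMean_le p fun i => Y i ω
    · rw [abs_mul, abs_of_nonneg (by positivity : (0 : ℝ) ≤ 2 / (p : ℝ) ^ 2)]
      refine mul_le_mul_of_nonneg_left ((Finset.abs_sum_le_sum_abs _ _).trans
        (Finset.sum_le_sum fun i _ => ?_)) (by positivity)
      rw [abs_mul, abs_of_nonneg (shrinkWeight_nonneg (h.tau_pos i) g)]
      exact (mul_le_of_le_one_left (abs_nonneg _) (shrinkWeight_le_one (h.tau_pos i) g)).trans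
        (hU i ω)
  · have e1 : ∫ ω, (δ * 1 ^ 2 + G₁ ω / (δ * (p : ℝ) ^ 2)) ∂P =
        δ + (∫ ω, G₁ ω ∂P) / (δ * (p : ℝ) ^ 2) := by
      rw [integral_add (integrable_const _) (hG₁.div_const _), integral_div]; simp
    have e2 : ∫ ω, δ * (1 / p * ∑ i ∈ Finset.range p, Y i ω ^ 2) ∂P ≤ δ * K := by
      rw [integral_const_mul, integral_const_mul, integral_finsetSum _ fun i _ => hsqI i]
      refine mul_le_mul_of_nonneg_left ?_ hδ0.le
      rw [one_div, inv_mul_le_iff₀ hp', mul_comm (p : ℝ)]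
      exact (Finset.sum_le_sum fun i _ => h.sq_le i).trans hK
    have e4 : ∫ ω, 2 / (p : ℝ) ^ 2 * ∑ i ∈ Finset.range p, U i ω ∂P ≤
        2 / (p : ℝ) ^ 2 * (2 * (K * p) + p) := by
      rw [integral_const_mul, integral_finsetSum _ fun i _ => hUI i]
      refine mul_le_mul_of_nonneg_left ((Finset.sum_le_sum fun i _ => hUE i).trans ?_)
        (by positivity)
      rw [Finset.sum_add_distrib, ← Finset.mul_sum]
      simp only [Finset.sum_const, Finset.card_range, nsmul_eq_mul, mul_one]
      linarith
    have eG : ∀ E : ℝ, E ≤ 4 * (√p + 1) * ∑ i ∈ Finset.range p, v i →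
        E / (δ * (p : ℝ) ^ 2) ≤ 8 * K / x := by
      intro E hE
      have h1 : E ≤ 8 * x ^ 2 * (K * x ^ 4) := by
        refine hE.trans ?_
        rw [hx2, ← hx4]
        have : x ^ 2 ≥ 1 := by nlinarith
        have h5 : 0 ≤ ∑ i ∈ Finset.range p, v i := Finset.sum_nonneg fun i _ => hv0 i
        refine mul_le_mul (by linarith) hK h5 (by positivity)
      have h2 : 8 * K / x * (δ * (p : ℝ) ^ 2) = 8 * x ^ 2 * (K * x ^ 4) := by
        rw [hδ, hx4]; field_simp
      rw [div_le_iff₀ (by positivity), h2]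
      exact h1
    rw [integral_add hI123 hI4, integral_add hI1 hI23,
      integral_add hI2 hI3, e1, integral_div]
    have f1 := eG _ hE₁
    have f2 := eG _ hE₂
    have f3 : 2 / (p : ℝ) ^ 2 * (2 * (K * p) + p) ≤ (2 + 4 * K) / x := by
      rw [hx4]
      have : 2 / (x ^ 4) ^ 2 * (2 * (K * x ^ 4) + x ^ 4) = (2 + 4 * K) / x ^ 4 := by
        field_simp; ring
      rw [this]
      have : x ≤ x ^ 4 := le_self_pow₀ hx1 (by norm_num)
      gcongr
    have f4 : (3 + 21 * K) / x = δ + 8 * K / x + (δ * K + 8 * K / x) + (2 + 4 * K) / x := by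
      rw [hδ]; field_simp; ring
    rw [f4]
    linarith

/-- Grand-mean shrinkage estimators with a data-dependent shrinkage parameter have finite risk. -/
lemma MomentControl.integrable_grandMeanLoss {Y : ℕ → Ω → ℝ} {ν₀ ν₁ ν₂ : ℝ} {τ θ v : ℕ → ℝ}
    (h : MomentControl P Y ν₀ ν₁ ν₂ τ θ v) (p : ℕ) {g : Ω → ℝ≥0∞} (hg : Measurable g) :
    Integrable (grandMeanLoss Y τ θ p g) P := by
  have hmean : MemLp (fun ω => grandMean p (fun i => Y i ω)) 2 P := by
    simp only [grandMean, div_eq_mul_inv]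
    exact (memLp_finsetSum (Finset.range p) fun i _ => h.memLp i).mul_const _
  have hw : ∀ i, Measurable fun ω => shrinkWeight (τ i) (g ω) := fun i =>
    (measurable_shrinkWeight (τ i)).comp hg
  unfold grandMeanLoss loss
  refine (integrable_finsetSum _ fun i _ => ?_).const_mul _
  refine MemLp.integrable_sq ?_
  have hL : MemLp (fun ω => (|Y i ω| + |grandMean p (fun i => Y i ω)|) + |θ i|) 2 P :=
    ((h.memLp i).abs.add hmean.abs).add (memLp_const _)
  refine hL.mono' ?_ (Eventually.of_forall fun ω => ?_)
  · unfold grandMeanEstimate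
    refine AEStronglyMeasurable.sub (AEStronglyMeasurable.add
      (AEStronglyMeasurable.mul ?_ (h.memLp i).aestronglyMeasurable)
      (AEStronglyMeasurable.mul ?_ hmean.aestronglyMeasurable)) aestronglyMeasurable_const
    · exact (measurable_const.sub (hw i)).aestronglyMeasurable
    · exact (hw i).aestronglyMeasurable
  · rw [Real.norm_eq_abs]
    unfold grandMeanEstimate
    have h0 := shrinkWeight_nonneg (h.tau_pos i) (g ω)
    have h1 := shrinkWeight_le_one (h.tau_pos i) (g ω)
    refine (abs_sub _ _).trans (add_le_add ((abs_add_le _ _).trans (add_le_add ?_ ?_)) le_rfl)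
    · rw [abs_mul, abs_of_nonneg (sub_nonneg.2 h1)]
      exact mul_le_of_le_one_left (abs_nonneg _) (by linarith)
    · rw [abs_mul, abs_of_nonneg h0]
      exact mul_le_of_le_one_left (abs_nonneg _) h1

/-! ### Asymptotic optimality of the minimizer -/

/-- The risk estimate is uniformly close to the loss in the mean, so that its minimizer is
asymptotically optimal. -/
lemma MomentControl.exists_loss_sub_le {Y : ℕ → Ω → ℝ} {ν₀ ν₁ ν₂ : ℝ} {τ θ v : ℕ → ℝ}
    (h : MomentControl P Y ν₀ ν₁ ν₂ τ θ v) (hY : iIndepFun Y P)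
    (hv : (fun p : ℕ => ∑ i ∈ Finset.range p, v i) =O[atTop] (fun p : ℕ => (p : ℝ)))
    {g₀ : ℕ → Ω → ℝ≥0∞}
    (hmin : ∀ p ω, ∀ g : ℝ≥0∞, urePG ν₀ ν₁ ν₂ τ p (fun i => Y i ω) (g₀ p ω) ≤
      urePG ν₀ ν₁ ν₂ τ p (fun i => Y i ω) g) (g : ℕ → Ω → ℝ≥0∞) :
    ∃ b : ℕ → ℝ, Tendsto b atTop (𝓝 0) ∧ ∀ᶠ p in atTop, ∃ B : Ω → ℝ, Integrable B P ∧
      (∀ ω, 0 ≤ B ω) ∧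
      (∀ ω, grandMeanLoss Y τ θ p (g₀ p) ω - grandMeanLoss Y τ θ p (g p) ω ≤ B ω) ∧
      ∫ ω, B ω ∂P ≤ b p := by
  obtain ⟨K, hK⟩ := hv.bound
  -- The factor 2 arises because the uniform bound is used at both `g₀ p ω` and `g p ω`; the
  -- constant `c` is common to the two and cancels.
  refine ⟨fun p => 2 * ((3 + 21 * K) / √√p), ?_, ?_⟩
  · rw [← mul_zero (2 : ℝ)]
    refine Tendsto.const_mul 2 (Tendsto.const_div_atTop ?_ _)
    exact Real.tendsto_sqrt_atTop.comp
      (Real.tendsto_sqrt_atTop.comp tendsto_natCast_atTop_atTop)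
  · filter_upwards [hK, eventually_gt_atTop 0] with p hKp hp
    have hKp' : ∑ i ∈ Finset.range p, v i ≤ K * p := by
      rw [Real.norm_eq_abs, Real.norm_natCast] at hKp
      exact (le_abs_self _).trans hKp
    obtain ⟨B, hB, hle, hE⟩ := h.exists_bound hY hp hKp'
    refine ⟨fun ω => 2 * B ω, hB.const_mul 2, fun ω => ?_, fun ω => ?_, ?_⟩
    · obtain ⟨c, hc⟩ := hle ω
      have := (abs_nonneg _).trans (hc 0)
      positivity
    · obtain ⟨c, hc⟩ := hle ω
      have h1 := (abs_le.1 (hc (g₀ p ω))).1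
      have h2 := (abs_le.1 (hc (g p ω))).2
      have h3 := hmin p ω (g p ω)
      simp only [grandMeanLoss]
      linarith
    · rw [integral_const_mul]
      exact mul_le_mul_of_nonneg_left hE zero_le_two

/-- Asymptotic optimality of the minimizer of the risk estimate, given moment bounds. -/
lemma MomentControl.optimality {Y : ℕ → Ω → ℝ} {ν₀ ν₁ ν₂ : ℝ} {τ θ v : ℕ → ℝ}
    (h : MomentControl P Y ν₀ ν₁ ν₂ τ θ v) (hY : iIndepFun Y P)
    (hv : (fun p : ℕ => ∑ i ∈ Finset.range p, v i) =O[atTop] (fun p : ℕ => (p : ℝ)))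
    {g₀ : ℕ → Ω → ℝ≥0∞} (hg₀ : ∀ p, Measurable (g₀ p))
    (hmin : ∀ p ω, ∀ g : ℝ≥0∞, urePG ν₀ ν₁ ν₂ τ p (fun i => Y i ω) (g₀ p ω) ≤
      urePG ν₀ ν₁ ν₂ τ p (fun i => Y i ω) g) {g : ℕ → Ω → ℝ≥0∞} (hg : ∀ p, Measurable (g p)) :
    (∀ ε : ℝ, 0 < ε → Tendsto (fun p : ℕ => P {ω | grandMeanLoss Y τ θ p (g₀ p) ω ≥
        grandMeanLoss Y τ θ p (g p) ω + ε}) atTop (𝓝 0)) ∧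
    limsup (fun p : ℕ => ((grandMeanRisk P Y τ θ p (g₀ p) -
        grandMeanRisk P Y τ θ p (g p) : ℝ) : EReal)) atTop ≤ 0 := by
  obtain ⟨b, hb, hB⟩ := h.exists_loss_sub_le hY hv hmin g
  constructor
  · intro ε hε
    have hlim : Tendsto (fun p => ENNReal.ofReal (b p / ε)) atTop (𝓝 0) := by
      rw [← ENNReal.ofReal_zero]
      refine ENNReal.tendsto_ofReal ?_
      simpa using hb.div_const ε
    refine tendsto_of_tendsto_of_tendsto_of_le_of_le' tendsto_const_nhds hlim
      (Eventually.of_forall fun _ => zero_le) ?_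
    filter_upwards [hB] with p ⟨B, hBi, hB0, hle, hE⟩
    have hsub : {ω | grandMeanLoss Y τ θ p (g₀ p) ω ≥ grandMeanLoss Y τ θ p (g p) ω + ε} ⊆
        {ω | ε ≤ B ω} := by
      intro ω hω
      have h1 : grandMeanLoss Y τ θ p (g₀ p) ω ≥ grandMeanLoss Y τ θ p (g p) ω + ε := hω
      have h2 := hle ω
      show ε ≤ B ω
      linarith
    refine (measure_mono hsub).trans ?_
    have hM := mul_meas_ge_le_integral_of_nonneg (Eventually.of_forall hB0) hBi ε
    rw [← ENNReal.ofReal_toReal (measure_ne_top P {ω | ε ≤ B ω})]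
    refine ENNReal.ofReal_le_ofReal ?_
    rw [le_div_iff₀ hε, mul_comm]
    exact hM.trans hE
  · have hlim : Tendsto (fun p => ((b p : ℝ) : EReal)) atTop (𝓝 ((0 : ℝ) : EReal)) :=
      (continuous_coe_real_ereal.tendsto 0).comp hb
    calc _ ≤ limsup (fun p => ((b p : ℝ) : EReal)) atTop := by
          refine limsup_le_limsup ?_
          filter_upwards [hB] with p ⟨B, hBi, _, hle, hE⟩
          refine EReal.coe_le_coe_iff.2 ?_
          unfold grandMeanRisk
          have h1 := h.integrable_grandMeanLoss p (hg₀ p)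
          have h2 := h.integrable_grandMeanLoss p (hg p)
          rw [← integral_sub h1 h2]
          exact (integral_mono (h1.sub h2) hBi hle).trans hE
      _ = 0 := hlim.limsup_eq

/-! ### From the first four moments to `MomentControl` -/

lemma integrable_pow_of_le_four {X : Ω → ℝ} (hX : AEStronglyMeasurable X P)
    (h4 : Integrable (fun ω => X ω ^ 4) P) {k : ℕ} (hk : k ≤ 4) :
    Integrable (fun ω => X ω ^ k) P := by
  refine ((integrable_const (1 : ℝ)).add h4).mono' (hX.pow k) (Eventually.of_forall fun ω => ?_)
  simp only [Pi.add_apply]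
  rw [Real.norm_eq_abs, abs_pow]
  have h0 : |X ω| ^ 4 = X ω ^ 4 := Even.pow_abs ⟨2, rfl⟩ _
  rcases le_total |X ω| 1 with h | h
  · have := pow_le_one₀ (abs_nonneg (X ω)) h (n := k)
    have : 0 ≤ X ω ^ 4 := by positivity
    linarith
  · have := pow_le_pow_right₀ h hk
    linarith

/-- Moments of a scaled variable, from the moments of an unscaled law. -/
lemma moments_of_law {Ω : Type*} [MeasurableSpace Ω] {P : Measure Ω} {α : Type*}
    [MeasurableSpace α] {μ : Measure α} {X : α → ℝ}
    (hX : Measurable X) {Y : Ω → ℝ} (hY : Measurable Y) {t : ℝ}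
    (law : P.map Y = μ.map (fun a => X a / t)) (h4 : Integrable (fun a => X a ^ 4) μ) :
    Integrable (fun ω => Y ω ^ 4) P ∧
      ∀ k, ∫ ω, Y ω ^ k ∂P = (∫ a, X a ^ k ∂μ) / t ^ k := by
  have hX' : Measurable fun a => X a / t := hX.div_const t
  constructor
  · have h : Integrable (fun y : ℝ => y ^ 4) (P.map Y) := by
      rw [law]
      refine (integrable_map_measure (by fun_prop) hX'.aemeasurable).2 ?_
      simp only [Function.comp_def, div_pow]
      exact h4.div_const _
    exact h.comp_measurable hY
  · intro k
    have h1 : ∫ ω, Y ω ^ k ∂P = ∫ y, y ^ k ∂(P.map Y) :=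
      (integral_map hY.aemeasurable (f := fun y : ℝ => y ^ k) (by fun_prop)).symm
    rw [h1, law, integral_map hX'.aemeasurable (by fun_prop)]
    simp only [div_pow]
    rw [integral_div]

/-- Reads the total mass of a law off the hypothesis that some `Y` follows it, which spares summing
the negative binomial series. -/
lemma isProbabilityMeasure_of_law {α : Type*} [MeasurableSpace α] {μ : Measure α} {X : α → ℝ}
    (hX : Measurable X) {Y : Ω → ℝ} (hY : Measurable Y) (law : P.map Y = μ.map X) :
    IsProbabilityMeasure μ := by
  have h := Measure.isProbabilityMeasure_map (μ := P) hY.aemeasurable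
  rw [law] at h
  constructor
  have := h.measure_univ
  rwa [Measure.map_apply hX MeasurableSet.univ, Set.preimage_univ] at this

/-- As an explicit quadratic in `y`, the discrepancy has a second moment determined by four moments
of the observation. -/
lemma varDiscrepancy_eq {ν₀ ν₁ ν₂ t m y : ℝ} (ht : 0 < t + ν₂) :
    varDiscrepancy ν₀ ν₁ ν₂ t m y =
      t / (t + ν₂) * y ^ 2 + -(m + ν₁ / (t + ν₂)) * y + -(ν₀ / (t + ν₂)) := by
  unfold varDiscrepancy varEstimate
  field_simp
  ring

/-- First and second moments of a quadratic polynomial in a random variable. -/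
lemma integral_quadratic {Y : Ω → ℝ} (hY : AEStronglyMeasurable Y P)
    (h4 : Integrable (fun ω => Y ω ^ 4) P) (a b d : ℝ) :
    Integrable (fun ω => (a * Y ω ^ 2 + b * Y ω + d) ^ 2) P ∧
    ∫ ω, (a * Y ω ^ 2 + b * Y ω + d) ∂P =
      a * ∫ ω, Y ω ^ 2 ∂P + b * ∫ ω, Y ω ∂P + d ∧
    ∫ ω, (a * Y ω ^ 2 + b * Y ω + d) ^ 2 ∂P =
      a ^ 2 * ∫ ω, Y ω ^ 4 ∂P + 2 * a * b * ∫ ω, Y ω ^ 3 ∂P +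
        (b ^ 2 + 2 * a * d) * ∫ ω, Y ω ^ 2 ∂P + 2 * b * d * ∫ ω, Y ω ∂P + d ^ 2 := by
  have i1 : Integrable (fun ω => Y ω) P := by
    simpa using integrable_pow_of_le_four hY h4 (k := 1) (by norm_num)
  have i2 := integrable_pow_of_le_four hY h4 (k := 2) (by norm_num)
  have i3 := integrable_pow_of_le_four hY h4 (k := 3) (by norm_num)
  have heq : (fun ω => (a * Y ω ^ 2 + b * Y ω + d) ^ 2) = fun ω =>
      a ^ 2 * Y ω ^ 4 + 2 * a * b * Y ω ^ 3 + (b ^ 2 + 2 * a * d) * Y ω ^ 2 +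
        2 * b * d * Y ω + d ^ 2 := by
    ext ω; ring
  have j1 : Integrable (fun ω => a ^ 2 * Y ω ^ 4 + 2 * a * b * Y ω ^ 3) P :=
    (h4.const_mul _).add (i3.const_mul _)
  have j2 : Integrable (fun ω => a ^ 2 * Y ω ^ 4 + 2 * a * b * Y ω ^ 3 +
      (b ^ 2 + 2 * a * d) * Y ω ^ 2) P := j1.add (i2.const_mul _)
  have j3 : Integrable (fun ω => a ^ 2 * Y ω ^ 4 + 2 * a * b * Y ω ^ 3 +
      (b ^ 2 + 2 * a * d) * Y ω ^ 2 + 2 * b * d * Y ω) P := j2.add (i1.const_mul _)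
  have j4 : Integrable (fun ω => a * Y ω ^ 2 + b * Y ω) P :=
    (i2.const_mul _).add (i1.const_mul _)
  rw [heq]
  refine ⟨j3.add (integrable_const _), ?_, ?_⟩
  · rw [integral_add j4 (integrable_const _), integral_add (i2.const_mul _) (i1.const_mul _),
      integral_const_mul, integral_const_mul]
    simp
  · rw [integral_add j3 (integrable_const _), integral_add j2 (i1.const_mul _),
      integral_add j1 (i2.const_mul _), integral_add (h4.const_mul _) (i3.const_mul _),
      integral_const_mul, integral_const_mul, integral_const_mul, integral_const_mul]
    simp

/-- Exact first and second moments and bounded fourth moments give `MomentControl`. -/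
lemma MomentControl.of_moments {Y : ℕ → Ω → ℝ} (hY : ∀ i, Measurable (Y i)) {ν₀ ν₁ ν₂ : ℝ}
    {τ θ v : ℕ → ℝ} (hτ : ∀ i, 0 < τ i) (hτν : ∀ i, 0 < τ i + ν₂)
    (h4 : ∀ i, Integrable (fun ω => Y i ω ^ 4) P) (h1 : ∀ i, ∫ ω, Y i ω ∂P = θ i)
    (h2 : ∀ i, ∫ ω, Y i ω ^ 2 ∂P = θ i ^ 2 + (ν₀ + ν₁ * θ i + ν₂ * θ i ^ 2) / τ i)
    (hv : ∀ i, ∫ ω, Y i ω ^ 2 ∂P ≤ v i)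
    (hz : ∀ i, ∫ ω, varDiscrepancy ν₀ ν₁ ν₂ (τ i) (θ i) (Y i ω) ^ 2 ∂P ≤ v i) :
    MomentControl P Y ν₀ ν₁ ν₂ τ θ v where
  tau_pos := hτ
  memLp i := (memLp_two_iff_integrable_sq (hY i).aestronglyMeasurable).2
    (integrable_pow_of_le_four (hY i).aestronglyMeasurable (h4 i) (by norm_num))
  memLp_discrepancy i := by
    simp only [varDiscrepancy_eq (hτν i)]
    have := hY i
    exact (memLp_two_iff_integrable_sq (by fun_prop)).2
      (integral_quadratic (hY i).aestronglyMeasurable (h4 i) _ _ _).1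
  mean := h1
  -- Unbiasedness: the second moment gives `E V(Y) = V(θ) * (1 + ν₂ / τ)`, so division by `τ + ν₂`
  -- yields `V(θ) / τ`, which is also `E (Y - θ) * Y`.
  mean_discrepancy i := by
    simp only [varDiscrepancy_eq (hτν i)]
    rw [(integral_quadratic (hY i).aestronglyMeasurable (h4 i) _ _ _).2.1, h1, h2]
    have := (hτ i).ne'
    have := (hτν i).ne'
    field_simp
    ring
  sq_le := hv
  sq_discrepancy_le := hz

lemma integral_sq_varDiscrepancy {Y : Ω → ℝ} (hY : Measurable Y) {ν₀ ν₁ ν₂ t m : ℝ}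
    (ht : 0 < t + ν₂) (h4 : Integrable (fun ω => Y ω ^ 4) P) :
    ∫ ω, varDiscrepancy ν₀ ν₁ ν₂ t m (Y ω) ^ 2 ∂P =
      (t / (t + ν₂)) ^ 2 * ∫ ω, Y ω ^ 4 ∂P +
        2 * (t / (t + ν₂)) * -(m + ν₁ / (t + ν₂)) * ∫ ω, Y ω ^ 3 ∂P +
        ((-(m + ν₁ / (t + ν₂))) ^ 2 + 2 * (t / (t + ν₂)) * -(ν₀ / (t + ν₂))) *
          ∫ ω, Y ω ^ 2 ∂P +
        2 * -(m + ν₁ / (t + ν₂)) * -(ν₀ / (t + ν₂)) * ∫ ω, Y ω ∂P +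
        (-(ν₀ / (t + ν₂))) ^ 2 := by
  simp only [varDiscrepancy_eq ht]
  exact (integral_quadratic hY.aestronglyMeasurable h4 _ _ _).2.2

/-- Carries the growth condition on a power of the parameters over to majorants of the form `v i = C
* (1 + a i)`. -/
lemma isBigO_sum_const_mul_one_add {a : ℕ → ℝ} (C : ℝ)
    (h : (fun p : ℕ => ∑ i ∈ Finset.range p, a i) =O[atTop] (fun p : ℕ => (p : ℝ))) :
    (fun p : ℕ => ∑ i ∈ Finset.range p, C * (1 + a i)) =O[atTop] (fun p : ℕ => (p : ℝ)) := by
  simp only [← Finset.mul_sum, Finset.sum_add_distrib]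
  refine Asymptotics.IsBigO.const_mul_left (Asymptotics.IsBigO.add ?_ h) C
  simpa using Asymptotics.isBigO_refl _ _

/-! ### Laws on `ℕ` whose weights satisfy a two-term recursion -/

/-- The recursion `(k + 1) m (k + 1) = (A + B k) m k` of the weights of the Poisson and negative
binomial laws makes all fourth moments finite. -/
lemma summable_pow_four_mul {m : ℕ → ℝ} {A B : ℝ} (hm : ∀ k, 0 < m k) (hB : B < 1) (hB0 : 0 ≤ B)
    (hrec : ∀ k : ℕ, ((k : ℝ) + 1) * m (k + 1) = (A + B * k) * m k) :
    Summable fun k : ℕ => m k * (k : ℝ) ^ 4 := by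
  have hA : 0 < A := by
    have := hrec 0
    have h1 := hm 0
    have h2 := hm 1
    simp only [Nat.cast_zero, zero_add, one_mul, mul_zero, add_zero] at this
    by_contra h
    nlinarith
  refine summable_of_ratio_test_tendsto_lt_one hB ?_ ?_
  · filter_upwards [eventually_gt_atTop 0] with k hk
    have : (0 : ℝ) < k := by exact_mod_cast hk
    have := hm k
    positivity
  · have h1 : Tendsto (fun k : ℕ => (1 + 1 / (k : ℝ)) ^ 4 *
        (A * (1 / ((k : ℝ) + 1)) + B * ((k : ℝ) / (k + 1)))) atTop (𝓝 B) := by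
      have e : B = (1 + 0) ^ 4 * (A * 0 + B * 1) := by ring
      nth_rewrite 2 [e]
      refine Tendsto.mul ((tendsto_const_nhds.add tendsto_one_div_atTop_nhds_zero_nat).pow 4)
        (Tendsto.add (tendsto_one_div_add_atTop_nhds_zero_nat.const_mul _)
          (Tendsto.const_mul _ ?_))
      exact tendsto_natCast_div_add_atTop (1 : ℝ)
    refine h1.congr' ?_
    filter_upwards [eventually_gt_atTop 0] with k hk
    have hk' : (0 : ℝ) < k := by exact_mod_cast hk
    have := hm k
    have := hm (k + 1)
    have hr : m (k + 1) = (A + B * k) * m k / (k + 1) := by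
      rw [eq_div_iff (by positivity), ← hrec k]; ring
    rw [Real.norm_of_nonneg (by positivity), Real.norm_of_nonneg (by positivity), hr]
    push_cast
    field_simp

/-- The first four moments of such a law. -/
lemma moments_of_recursion {m : ℕ → ℝ} {A B : ℝ} (hm : ∀ k, 0 < m k) (hB : B < 1) (hB0 : 0 ≤ B)
    (hrec : ∀ k : ℕ, ((k : ℝ) + 1) * m (k + 1) = (A + B * k) * m k) {μ : Measure ℕ}
    [IsProbabilityMeasure μ]
    (hμ : μ = Measure.sum fun k : ℕ => ENNReal.ofReal (m k) • Measure.dirac k) :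
    Integrable (fun k : ℕ => (k : ℝ) ^ 4) μ ∧ ∃ e : ℕ → ℝ, (∀ j, ∫ k : ℕ, (k : ℝ) ^ j ∂μ = e j) ∧
      e 1 = A + B * e 1 ∧ e 2 = A * (e 1 + 1) + B * (e 2 + e 1) ∧
      e 3 = A * (e 2 + 2 * e 1 + 1) + B * (e 3 + 2 * e 2 + e 1) ∧
      e 4 = A * (e 3 + 3 * e 2 + 3 * e 1 + 1) + B * (e 4 + 3 * e 3 + 3 * e 2 + e 1) := by
  have hI : Integrable (fun k : ℕ => (k : ℝ) ^ 4) μ := by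
    rw [hμ]
    refine integrable_sum_dirac (by simp) ?_
    convert summable_pow_four_mul hm hB hB0 hrec using 2 with k
    rw [ENNReal.toReal_ofReal (hm k).le, Real.norm_of_nonneg (by positivity)]
  have hsum : ∀ f : ℕ → ℝ, Integrable f μ → HasSum (fun k => m k * f k) (∫ k, f k ∂μ) := by
    intro f hf
    rw [hμ] at hf ⊢
    have := hasSum_integral_sum_dirac (by simp) hf.summable_of_dirac
    simpa [ENNReal.toReal_ofReal (hm _).le] using this
  have hpow : ∀ j ≤ 4, HasSum (fun k : ℕ => m k * (k : ℝ) ^ j) (∫ k : ℕ, (k : ℝ) ^ j ∂μ) :=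
    fun j hj => hsum _ (integrable_pow_of_le_four (by fun_prop) hI hj)
  set e : ℕ → ℝ := fun j => ∫ k : ℕ, (k : ℝ) ^ j ∂μ with he
  have he0 : e 0 = 1 := by simp [he]
  -- Shift the index, dropping the zero term at `k = 0`, and insert the recursion: `e (j + 1)` is
  -- the mean of `(A + B * k) * (k + 1) ^ j`. Expanding the power gives the four relations; `e (j +
  -- 1)` returns on the right with the factor `B`, so they are implicit unless `B = 0`.
  have hstep : ∀ j < 4, HasSum (fun k : ℕ => m k * ((A + B * k) * ((k : ℝ) + 1) ^ j))
      (e (j + 1)) := by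
    intro j hj
    have h1 := hpow (j + 1) hj
    rw [← hasSum_nat_add_iff' 1] at h1
    simp only [Finset.range_one, Finset.sum_singleton, Nat.cast_zero, ne_eq, Nat.add_eq_zero_iff,
      one_ne_zero, and_false, not_false_eq_true, zero_pow, mul_zero, sub_zero] at h1
    refine h1.congr_fun ?_
    intro k
    push_cast
    have := hrec k
    calc m k * ((A + B * k) * ((k : ℝ) + 1) ^ j) = ((A + B * k) * m k) * ((k : ℝ) + 1) ^ j := by
          ring
      _ = _ := by rw [← this]; ring
  have p0 : HasSum (fun k : ℕ => m k * (k : ℝ) ^ 0) 1 := he0 ▸ hpow 0 (by norm_num)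
  have p1 : HasSum (fun k : ℕ => m k * (k : ℝ) ^ 1) (e 1) := hpow 1 (by norm_num)
  have p2 : HasSum (fun k : ℕ => m k * (k : ℝ) ^ 2) (e 2) := hpow 2 (by norm_num)
  have p3 : HasSum (fun k : ℕ => m k * (k : ℝ) ^ 3) (e 3) := hpow 3 (by norm_num)
  have p4 : HasSum (fun k : ℕ => m k * (k : ℝ) ^ 4) (e 4) := hpow 4 (by norm_num)
  refine ⟨hI, e, fun j => rfl, ?_, ?_, ?_, ?_⟩
  · have h := (p0.mul_left A).add (p1.mul_left B)
    rw [mul_one] at h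
    exact (hstep 0 (by norm_num)).unique (h.congr_fun fun k => by ring)
  · exact (hstep 1 (by norm_num)).unique
      ((((p1.add p0).mul_left A).add ((p2.add p1).mul_left B)).congr_fun fun k => by ring)
  · exact (hstep 2 (by norm_num)).unique
      (((((p2.add (p1.mul_left 2)).add p0).mul_left A).add
        (((p3.add (p2.mul_left 2)).add p1).mul_left B)).congr_fun fun k => by ring)
  · exact (hstep 3 (by norm_num)).unique
      ((((((p3.add (p2.mul_left 3)).add (p1.mul_left 3)).add p0).mul_left A).add
        ((((p4.add (p3.mul_left 3)).add (p2.mul_left 3)).add p1).mul_left B)).congr_fun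
          fun k => by ring)

/-! ### Binomial observations -/

lemma integral_binomial_eq_eval (n : ℕ) (q : unitInterval) (f : ℕ → ℝ) :
    ∫ k, f k ∂(ProbabilityTheory.binomial n q) =
      ∑ k ∈ Finset.range (n + 1), f k * (bernsteinPolynomial ℝ n k).eval (q : ℝ) := by
  rw [ProbabilityTheory.integral_binomial, Nat.range_succ_eq_Iic]
  refine Finset.sum_congr rfl fun k _ => ?_
  simp [bernsteinPolynomial, mul_comm]

lemma integral_natCast_binomial (n : ℕ) (q : unitInterval) :
    ∫ k : ℕ, (k : ℝ) ∂(ProbabilityTheory.binomial n q) = n * q := by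
  rw [integral_binomial_eq_eval]
  have h := congrArg (Polynomial.eval (q : ℝ)) (bernsteinPolynomial.sum_smul ℝ n)
  simpa [Polynomial.eval_finsetSum] using h

lemma integral_natCast_sq_binomial (n : ℕ) (q : unitInterval) :
    ∫ k : ℕ, (k : ℝ) ^ 2 ∂(ProbabilityTheory.binomial n q) =
      (n * q) ^ 2 + n * q * (1 - q) := by
  have h := congrArg (Polynomial.eval (q : ℝ)) (bernsteinPolynomial.variance ℝ n)
  have h1 : ∫ k : ℕ, (n * (q : ℝ) - k) ^ 2 ∂(ProbabilityTheory.binomial n q) =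
      n * q * (1 - q) := by
    rw [integral_binomial_eq_eval]
    simpa [Polynomial.eval_finsetSum] using h
  have h2 : (fun k : ℕ => (n * (q : ℝ) - k) ^ 2) = fun k : ℕ =>
      ((k : ℝ) ^ 2 + -(2 * (n * q)) * k) + (n * (q : ℝ)) ^ 2 := by
    ext k; ring
  rw [h2, integral_add (integrable_binomial _) (integrable_const _),
    integral_add (integrable_binomial _) (integrable_binomial _), integral_const_mul,
    integral_natCast_binomial] at h1
  simp only [integral_const, probReal_univ, smul_eq_mul, one_mul] at h1
  linarith

/-- Here boundedness suffices. Observations lie in `[0, 1]`, and so does the variance estimate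
because `n i - 1 ≥ 1`; the discrepancy is thus at most 2 in absolute value, and `v = 4` works. -/
lemma exists_momentControl_binomial {Y : ℕ → Ω → ℝ} (hY : ∀ i, Measurable (Y i)) (n : ℕ → ℕ)
    (q : ℕ → unitInterval)
    (law : ∀ i, P.map (Y i) =
      (ProbabilityTheory.binomial (n i) (q i)).map (fun k : ℕ => (k : ℝ) / (n i : ℝ)))
    (two_le : ∀ i, 2 ≤ n i) :
    ∃ v : ℕ → ℝ, MomentControl P Y 0 1 (-1) (fun i => (n i : ℝ)) (fun i => (q i : ℝ)) v ∧
      (fun p : ℕ => ∑ i ∈ Finset.range p, v i) =O[atTop] (fun p : ℕ => (p : ℝ)) := by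
  have hn : ∀ i, (2 : ℝ) ≤ n i := fun i => by exact_mod_cast two_le i
  have hlaw := fun i => moments_of_law (μ := ProbabilityTheory.binomial (n i) (q i))
    (X := fun k : ℕ => (k : ℝ)) (by fun_prop) (hY i) (law i) (integrable_binomial _)
  have hmem : ∀ i, ∀ᵐ ω ∂P, 0 ≤ Y i ω ∧ Y i ω ≤ 1 := by
    intro i
    have h1 : ∀ᵐ y ∂(P.map (Y i)), 0 ≤ y ∧ y ≤ 1 := by
      rw [law i, ae_map_iff (by fun_prop) measurableSet_Icc]
      filter_upwards [ae_le_of_hasLaw_binomial (X := id) (n := n i) (p := q i) HasLaw.id] with k hk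
      refine ⟨by positivity, div_le_one_of_le₀ ?_ (by positivity)⟩
      exact_mod_cast hk
    exact ae_of_ae_map (hY i).aemeasurable h1
  have hY2 : ∀ i, ∫ ω, Y i ω ^ 2 ∂P ≤ 4 := by
    intro i
    refine (integral_mono_ae (g := fun _ => (4 : ℝ)) (integrable_pow_of_le_four
      (hY i).aestronglyMeasurable (hlaw i).1 (by norm_num)) (integrable_const _) ?_).trans
      (by simp)
    filter_upwards [hmem i] with ω hω
    nlinarith
  refine ⟨fun _ => 4, MomentControl.of_moments hY (fun i => by have := hn i; positivity)
    (fun i => by have := hn i; linarith) (fun i => (hlaw i).1) (fun i => ?_) (fun i => ?_) hY2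
    (fun i => ?_), ?_⟩
  · have h := (hlaw i).2 1
    have := hn i
    simp only [pow_one, integral_natCast_binomial] at h
    rw [h]
    field_simp
  · have h := (hlaw i).2 2
    have := hn i
    rw [h, integral_natCast_sq_binomial]
    field_simp
    ring
  · have hI := (integral_quadratic (hY i).aestronglyMeasurable (hlaw i).1
      ((n i : ℝ) / (n i + -1)) (-(q i + 1 / ((n i : ℝ) + -1))) (-(0 / ((n i : ℝ) + -1)))).1
    have hpos : (0 : ℝ) < n i + -1 := by have := hn i; linarith
    simp only [← varDiscrepancy_eq hpos] at hI
    refine (integral_mono_ae (g := fun _ => (4 : ℝ)) hI (integrable_const _) ?_).trans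
      (by simp)
    filter_upwards [hmem i] with ω ⟨h0, h1⟩
    have hq0 := (q i).2.1
    have hq1 := (q i).2.2
    have hv0 : 0 ≤ varEstimate 0 1 (-1) (n i) (Y i ω) := by
      unfold varEstimate
      refine div_nonneg ?_ hpos.le
      nlinarith
    have hv1 : varEstimate 0 1 (-1) (n i) (Y i ω) ≤ 1 := by
      unfold varEstimate
      rw [div_le_one hpos]
      have := hn i
      nlinarith
    have h2 : |varDiscrepancy 0 1 (-1) (n i) (q i) (Y i ω)| ≤ 2 := by
      unfold varDiscrepancy
      rw [abs_le]
      constructor <;> nlinarith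
    rw [← sq_abs]
    nlinarith [abs_nonneg (varDiscrepancy 0 1 (-1) (n i) (q i) (Y i ω))]
  · simp only [Finset.sum_const, Finset.card_range, nsmul_eq_mul]
    simpa [mul_comm] using
      (Asymptotics.isBigO_refl (fun p : ℕ => (p : ℝ)) atTop).const_mul_left 4

/-! ### Poisson observations -/

/-- The fourth powers of `θ` cancel in the second moment `θ^3 / τ + 2 * θ^2 / τ^2` of the
discrepancy, which is why a condition on third powers is enough. -/
lemma exists_momentControl_poisson {Y : ℕ → Ω → ℝ} (hY : ∀ i, Measurable (Y i)) (τ θ : ℕ → ℝ)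
    (law : ∀ i, P.map (Y i) =
      (poissonMeasure (Real.toNNReal (τ i * θ i))).map (fun k : ℕ => (k : ℝ) / τ i))
    (inf_tau : ∃ c : ℝ, 0 < c ∧ ∀ i, c ≤ τ i)
    (inf_rate : ∃ c : ℝ, 0 < c ∧ ∀ i, c ≤ τ i * θ i)
    (moment : (fun p : ℕ => ∑ i ∈ Finset.range p, θ i ^ 3) =O[atTop] (fun p : ℕ => (p : ℝ))) :
    ∃ v : ℕ → ℝ, MomentControl P Y 0 1 0 τ θ v ∧
      (fun p : ℕ => ∑ i ∈ Finset.range p, v i) =O[atTop] (fun p : ℕ => (p : ℝ)) := by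
  obtain ⟨c, hc, hcτ⟩ := inf_tau
  obtain ⟨d, hd, hdτ⟩ := inf_rate
  have hτ : ∀ i, 0 < τ i := fun i => hc.trans_le (hcτ i)
  have hμ : ∀ i, 0 < τ i * θ i := fun i => hd.trans_le (hdτ i)
  have hθ : ∀ i, 0 < θ i := fun i => (mul_pos_iff_of_pos_left (hτ i)).1 (hμ i)
  have hmom : ∀ i, Integrable (fun ω => Y i ω ^ 4) P ∧ ∫ ω, Y i ω ∂P = θ i ∧
      ∫ ω, Y i ω ^ 2 ∂P = θ i ^ 2 + θ i / τ i ∧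
      ∫ ω, varDiscrepancy 0 1 0 (τ i) (θ i) (Y i ω) ^ 2 ∂P =
        θ i ^ 3 / τ i + 2 * θ i ^ 2 / τ i ^ 2 := by
    intro i
    have hr : ((Real.toNNReal (τ i * θ i) : NNReal) : ℝ) = τ i * θ i :=
      Real.coe_toNNReal _ (hμ i).le
    obtain ⟨hI, e, he, h1, h2, h3, h4⟩ := moments_of_recursion
      (m := fun k : ℕ => Real.exp (-(Real.toNNReal (τ i * θ i) : NNReal)) *
        (Real.toNNReal (τ i * θ i) : NNReal) ^ k / (k.factorial : ℝ))
      (A := τ i * θ i) (B := 0) (μ := poissonMeasure (Real.toNNReal (τ i * θ i)))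
      (fun k => by rw [hr]; have := hμ i; positivity) zero_lt_one le_rfl
      (fun k => by
        rw [hr, Nat.factorial_succ]
        push_cast
        have : (0 : ℝ) < k.factorial := by positivity
        field_simp
        ring) rfl
    obtain ⟨hI4, hk⟩ := moments_of_law (X := fun k : ℕ => (k : ℝ)) (by fun_prop) (hY i) (law i) hI
    have hk1 := hk 1
    simp only [pow_one] at hk1
    have he1 := he 1
    simp only [pow_one] at he1
    have := (hτ i).ne'
    simp only [zero_mul, add_zero] at h1 h2 h3 h4
    refine ⟨hI4, ?_, ?_, ?_⟩
    · rw [hk1, he1, h1]; field_simp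
    · rw [hk 2, he 2, h2, h1]; field_simp
    · rw [integral_sq_varDiscrepancy (hY i) (by simpa using hτ i) hI4, hk 4, hk 3, hk 2, hk1,
        he 4, he 3, he 2, he1, h4, h3, h2, h1]
      simp only [add_zero, zero_div]
      field_simp
      ring
  refine ⟨fun i => (1 + 1 / c + 2 / c ^ 2) * (1 + θ i ^ 3), MomentControl.of_moments hY hτ
    (by simpa using hτ) (fun i => (hmom i).1) (fun i => (hmom i).2.1) (fun i => ?_) (fun i => ?_)
    (fun i => ?_), isBigO_sum_const_mul_one_add _ moment⟩
  · rw [(hmom i).2.2.1]; ring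
  all_goals
    have h0 := hθ i
    have h1 : θ i ≤ 1 + θ i ^ 3 := by nlinarith [sq_nonneg (θ i - 1), sq_nonneg (θ i)]
    have h2 : θ i ^ 2 ≤ 1 + θ i ^ 3 := by nlinarith [sq_nonneg (θ i - 1), sq_nonneg (θ i)]
    have h3 : θ i ^ 3 ≤ 1 + θ i ^ 3 := by linarith
    have hcc : 0 < 1 / c := by positivity
    have hcc2 : 0 < 2 / c ^ 2 := by positivity
    have hpos : 0 < 1 + θ i ^ 3 := by positivity
    have hτ1 : 1 / τ i ≤ 1 / c := one_div_le_one_div_of_le hc (hcτ i)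
    have hτ2 : 2 / τ i ^ 2 ≤ 2 / c ^ 2 := by have := hcτ i; gcongr
  · rw [(hmom i).2.2.1]
    have e1 : θ i / τ i ≤ 1 / c * (1 + θ i ^ 3) := by
      rw [div_eq_mul_one_div, mul_comm]
      exact mul_le_mul hτ1 h1 h0.le hcc.le
    nlinarith
  · rw [(hmom i).2.2.2]
    have e1 : θ i ^ 3 / τ i ≤ 1 / c * (1 + θ i ^ 3) := by
      rw [div_eq_mul_one_div, mul_comm]
      exact mul_le_mul hτ1 h3 (by positivity) hcc.le
    have e2 : 2 * θ i ^ 2 / τ i ^ 2 ≤ 2 / c ^ 2 * (1 + θ i ^ 3) := by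
      rw [mul_div_right_comm]
      exact mul_le_mul hτ2 h2 (by positivity) hcc2.le
    nlinarith

/-! ### Negative binomial observations -/

/-- With `t` the mean, the second moment of the discrepancy is at most `10 * (1 + t^4) / n`, and `n
≥ n * q ≥ c`. -/
lemma exists_momentControl_negBinomial {Y : ℕ → Ω → ℝ} (hY : ∀ i, Measurable (Y i))
    (n q : ℕ → ℝ) (n_pos : ∀ i, 0 < n i) (q_mem : ∀ i, q i ∈ Set.Ioo (0 : ℝ) 1)
    (law : ∀ i, P.map (Y i) =
      (negBinomialMeasure (n i) (q i)).map (fun k : ℕ => (k : ℝ) / n i))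
    (inf_rate : ∃ c : ℝ, 0 < c ∧ ∀ i, c ≤ n i * q i)
    (moment : (fun p : ℕ => ∑ i ∈ Finset.range p, (q i / (1 - q i)) ^ 4)
      =O[atTop] (fun p : ℕ => (p : ℝ))) :
    ∃ v : ℕ → ℝ, MomentControl P Y 0 1 1 n (fun i => q i / (1 - q i)) v ∧
      (fun p : ℕ => ∑ i ∈ Finset.range p, v i) =O[atTop] (fun p : ℕ => (p : ℝ)) := by
  obtain ⟨c, hc, hcn⟩ := inf_rate
  have hcn' : ∀ i, c ≤ n i := fun i =>
    (hcn i).trans (mul_le_of_le_one_right (n_pos i).le (q_mem i).2.le)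
  have hθ : ∀ i, 0 < q i / (1 - q i) := fun i => div_pos (q_mem i).1 (sub_pos.2 (q_mem i).2)
  have hmom : ∀ i, Integrable (fun ω => Y i ω ^ 4) P ∧ ∫ ω, Y i ω ∂P = q i / (1 - q i) ∧
      ∫ ω, Y i ω ^ 2 ∂P =
        (q i / (1 - q i)) ^ 2 + (q i / (1 - q i)) * (1 + q i / (1 - q i)) / n i ∧
      ∫ ω, varDiscrepancy 0 1 1 (n i) (q i / (1 - q i)) (Y i ω) ^ 2 ∂P =
        (q i / (1 - q i)) ^ 2 * ((q i / (1 - q i)) ^ 2 * (n i + 3) +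
          (q i / (1 - q i)) * (n i + 5) + 2) / (n i * (n i + 1)) := by
    intro i
    have hq0 := (q_mem i).1
    have hq1 : 0 < 1 - q i := sub_pos.2 (q_mem i).2
    have hn := n_pos i
    have hprob : IsProbabilityMeasure (negBinomialMeasure (n i) (q i)) :=
      isProbabilityMeasure_of_law (by fun_prop) (hY i) (law i)
    obtain ⟨hI, e, he, h1, h2, h3, h4⟩ := moments_of_recursion
      (m := fun k : ℕ => Real.Gamma (n i + k) / (Real.Gamma (n i) * (k.factorial : ℝ)) * q i ^ k *
        (1 - q i) ^ n i)
      (A := q i * n i) (B := q i) (μ := negBinomialMeasure (n i) (q i))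
      (fun k => by
        have := Real.Gamma_pos_of_pos hn
        have := Real.Gamma_pos_of_pos (show 0 < n i + k by positivity)
        have := Real.rpow_pos_of_pos hq1 (n i)
        positivity) (q_mem i).2 hq0.le
      (fun k => by
        have hG := Real.Gamma_add_one (show n i + k ≠ 0 by positivity)
        rw [add_assoc] at hG
        have := (Real.Gamma_pos_of_pos hn).ne'
        rw [Nat.factorial_succ]
        push_cast
        rw [hG]
        have : (0 : ℝ) < k.factorial := by positivity
        field_simp
        ring) rfl
    obtain ⟨hI4, hk⟩ := moments_of_law (X := fun k : ℕ => (k : ℝ)) (by fun_prop) (hY i) (law i) hI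
    have hk1 := hk 1
    simp only [pow_one] at hk1
    have he1 := he 1
    simp only [pow_one] at he1
    set t := q i / (1 - q i) with ht
    -- Since `1 - q = 1 / (1 + t)`, solving each implicit relation for its top moment amounts to
    -- multiplying by `1 + t`.
    have hqt : q i = t / (1 + t) := by rw [ht]; field_simp; ring
    have ht0 : 0 < t := hθ i
    have h1' : e 1 = n i * t := by
      rw [hqt] at h1
      field_simp at h1
      linarith
    have h2' : e 2 = n i * t * (e 1 + 1) + t * e 1 := by
      rw [hqt] at h2
      field_simp at h2
      linarith
    have h3' : e 3 = n i * t * (e 2 + 2 * e 1 + 1) + t * (2 * e 2 + e 1) := by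
      rw [hqt] at h3
      field_simp at h3
      linarith
    have h4' : e 4 = n i * t * (e 3 + 3 * e 2 + 3 * e 1 + 1) + t * (3 * e 3 + 3 * e 2 + e 1) := by
      rw [hqt] at h4
      field_simp at h4
      linarith
    refine ⟨hI4, ?_, ?_, ?_⟩
    · rw [hk1, he1, h1']; field_simp
    · rw [hk 2, he 2, h2', h1']; field_simp; ring
    · rw [integral_sq_varDiscrepancy (hY i) (by positivity) hI4, hk 4, hk 3, hk 2, hk1,
        he 4, he 3, he 2, he1, h4', h3', h2', h1']
      field_simp
      ring
  have hnpos : ∀ i, 0 < n i + 1 := fun i => by have := n_pos i; positivity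
  refine ⟨fun i => (2 + 20 / c) * (1 + (q i / (1 - q i)) ^ 4), MomentControl.of_moments hY n_pos
    hnpos (fun i => (hmom i).1) (fun i => (hmom i).2.1) (fun i => ?_) (fun i => ?_)
    (fun i => ?_), isBigO_sum_const_mul_one_add _ moment⟩
  · rw [(hmom i).2.2.1]; ring
  all_goals
    have h0 := hθ i
    set t := q i / (1 - q i) with ht
    have hn := n_pos i
    have hpos : 0 < 1 + t ^ 4 := by positivity
    have h1 : t ≤ 1 + t ^ 4 := by nlinarith [sq_nonneg (t - 1), sq_nonneg (t ^ 2 - 1)]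
    have h2 : t ^ 2 ≤ 1 + t ^ 4 := by nlinarith [sq_nonneg (t ^ 2 - 1)]
    have h3 : t ^ 3 ≤ 1 + t ^ 4 := by
      nlinarith [sq_nonneg (t ^ 2 - 1), sq_nonneg (t ^ 2 - t), sq_nonneg (t - 1)]
    have hn1 : 1 / n i ≤ 1 / c := one_div_le_one_div_of_le hc (hcn' i)
  · rw [(hmom i).2.2.1, ← ht, div_eq_mul_one_div (t * (1 + t))]
    have e1 : t * (1 + t) * (1 / n i) ≤ (2 * (1 + t ^ 4)) * (1 / c) :=
      mul_le_mul (by linarith) hn1 (by positivity) (by positivity)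
    have e2 : (2 + 20 / c) * (1 + t ^ 4) = 2 * (1 + t ^ 4) + 20 * ((1 + t ^ 4) * (1 / c)) := by
      ring
    have e3 : 0 < (1 + t ^ 4) * (1 / c) := by positivity
    rw [e2]
    linarith
  · rw [(hmom i).2.2.2]
    have e1 : t ^ 2 * (t ^ 2 * (n i + 3) + t * (n i + 5) + 2) / (n i * (n i + 1)) ≤
        (10 * (1 + t ^ 4)) * (1 / n i) := by
      rw [mul_one_div, div_le_div_iff₀ (by positivity) hn]
      have e4 : t ^ 2 * (t ^ 2 * (n i + 3) + t * (n i + 5) + 2) ≤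
          10 * (1 + t ^ 4) * (n i + 1) := by
        have f1 := mul_le_mul_of_nonneg_right h3 (show 0 ≤ n i + 5 by positivity)
        have f2 : 0 < t ^ 4 * n i := by positivity
        have f3 : 0 < t ^ 4 := by positivity
        nlinarith
      calc _ ≤ 10 * (1 + t ^ 4) * (n i + 1) * n i := mul_le_mul_of_nonneg_right e4 hn.le
        _ = _ := by ring
    have e5 := mul_le_mul_of_nonneg_left hn1 (show 0 ≤ 10 * (1 + t ^ 4) by positivity)
    have e2 : (2 + 20 / c) * (1 + t ^ 4) = 2 * (1 + t ^ 4) + 20 * ((1 + t ^ 4) * (1 / c)) := by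
      ring
    have e3 : 0 < (1 + t ^ 4) * (1 / c) := by positivity
    rw [e2]
    linarith

/-! ### Gamma observations -/

/-- By `Γ(a + 1) = a * Γ(a)`, multiplying the density by `x` shifts the shape by one up to a
constant. The `k`-th moment thereby reduces to the total mass for shape `a + k`. -/
lemma pow_mul_gammaPDFReal {a r : ℝ} (ha : 0 < a) (hr : 0 < r) (k : ℕ) (x : ℝ) :
    x ^ k * gammaPDFReal a r x =
      (∏ j ∈ Finset.range k, (a + j)) / r ^ k * gammaPDFReal (a + k) r x := by
  induction k with
  | zero => simp
  | succ k ih =>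
    have hak : 0 < a + k := by positivity
    have hstep : x * gammaPDFReal (a + k) r x =
        (a + k) / r * gammaPDFReal (a + (k + 1 : ℕ)) r x := by
      unfold gammaPDFReal
      split_ifs with hx
      · have hG : Real.Gamma (a + (k + 1 : ℕ)) = (a + k) * Real.Gamma (a + k) := by
          rw [← Real.Gamma_add_one hak.ne']; push_cast; ring_nf
        have hx1 : x ^ (a + (k + 1 : ℕ) - 1) = x * x ^ (a + k - 1) := by
          -- The power law needs a positive base; at 0 both sides vanish because the exponent `a +
          -- k` is positive.
          rcases hx.eq_or_lt with rfl | hx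
          · rw [zero_mul, Real.zero_rpow]
            push_cast
            linarith
          · rw [show a + (k + 1 : ℕ) - 1 = 1 + (a + k - 1) by push_cast; ring,
              Real.rpow_add hx, Real.rpow_one]
        have hr1 : r ^ (a + (k + 1 : ℕ)) = r * r ^ (a + k) := by
          rw [show a + (k + 1 : ℕ) = 1 + (a + k) by push_cast; ring, Real.rpow_add hr,
            Real.rpow_one]
        rw [hG, hx1, hr1]
        have := (Real.Gamma_pos_of_pos hak).ne'
        field_simp
      · simp
    calc x ^ (k + 1) * gammaPDFReal a r x = x * (x ^ k * gammaPDFReal a r x) := by ring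
      _ = (∏ j ∈ Finset.range k, (a + j)) / r ^ k * (x * gammaPDFReal (a + k) r x) := by
        rw [ih]; ring
      _ = _ := by
        rw [hstep, Finset.prod_range_succ]
        field_simp
        ring

lemma moments_gammaMeasure {a r : ℝ} (ha : 0 < a) (hr : 0 < r) (k : ℕ) :
    Integrable (fun x : ℝ => x ^ k) (gammaMeasure a r) ∧
      ∫ x, x ^ k ∂(gammaMeasure a r) = (∏ j ∈ Finset.range k, (a + j)) / r ^ k := by
  have hak : 0 < a + k := by positivity
  have hint : ∫ x, gammaPDFReal (a + k) r x = 1 := by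
    rw [integral_eq_lintegral_of_nonneg_ae
      (Eventually.of_forall (gammaPDFReal_nonneg hak hr))
      (measurable_gammaPDFReal _ _).aestronglyMeasurable]
    exact (congrArg ENNReal.toReal (lintegral_gammaPDF_eq_one hak hr)).trans (by simp)
  have hmeas : Measurable (gammaPDF a r) := (measurable_gammaPDFReal a r).ennreal_ofReal
  have heq : (fun x => (gammaPDF a r x).toReal • x ^ k) = fun x =>
      (∏ j ∈ Finset.range k, (a + j)) / r ^ k * gammaPDFReal (a + k) r x := by
    ext x
    rw [gammaPDF, ENNReal.toReal_ofReal (gammaPDFReal_nonneg ha hr x), smul_eq_mul, mul_comm,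
      pow_mul_gammaPDFReal ha hr]
  have hlt : ∀ᵐ x, gammaPDF a r x < ∞ := Eventually.of_forall fun x => ENNReal.ofReal_lt_top
  constructor
  · rw [gammaMeasure, integrable_withDensity_iff_integrable_smul' hmeas hlt, heq]
    exact (Integrable.of_integral_ne_zero (by rw [hint]; exact one_ne_zero)).const_mul _
  · rw [gammaMeasure, integral_withDensity_eq_integral_toReal_smul hmeas hlt, heq,
      integral_const_mul, hint, mul_one]

/-- The second moment of the discrepancy is at most `3 * α^3 * lam^4 / τ`, whence the condition on
fourth powers. -/
lemma exists_momentControl_gamma {Y : ℕ → Ω → ℝ} (hY : ∀ i, Measurable (Y i)) (α : ℝ)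
    (α_pos : 0 < α) (τ lam : ℕ → ℝ) (lam_pos : ∀ i, 0 < lam i)
    (law : ∀ i, P.map (Y i) =
      (gammaMeasure (τ i * α) (lam i)⁻¹).map (fun x : ℝ => x / τ i))
    (inf_tau : ∃ c : ℝ, 0 < c ∧ ∀ i, c ≤ τ i)
    (moment : (fun p : ℕ => ∑ i ∈ Finset.range p, lam i ^ 4)
      =O[atTop] (fun p : ℕ => (p : ℝ))) :
    ∃ v : ℕ → ℝ, MomentControl P Y 0 0 (1 / α) τ (fun i => α * lam i) v ∧
      (fun p : ℕ => ∑ i ∈ Finset.range p, v i) =O[atTop] (fun p : ℕ => (p : ℝ)) := by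
  obtain ⟨c, hc, hcτ⟩ := inf_tau
  have hτ : ∀ i, 0 < τ i := fun i => hc.trans_le (hcτ i)
  have hτν : ∀ i, 0 < τ i + 1 / α := fun i => by have := hτ i; positivity
  have hmom : ∀ i, Integrable (fun ω => Y i ω ^ 4) P ∧ ∫ ω, Y i ω ∂P = α * lam i ∧
      ∫ ω, Y i ω ^ 2 ∂P = α * lam i ^ 2 * (α + 1 / τ i) ∧
      ∫ ω, varDiscrepancy 0 0 (1 / α) (τ i) (α * lam i) (Y i ω) ^ 2 ∂P =
        α ^ 3 * lam i ^ 4 * (τ i * α + 3) / (τ i * (τ i * α + 1)) := by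
    intro i
    have ha : 0 < τ i * α := mul_pos (hτ i) α_pos
    have hl := lam_pos i
    have ht := hτ i
    have hM := fun k => (moments_gammaMeasure ha (inv_pos.2 hl) k).2
    obtain ⟨hI4, hk⟩ := moments_of_law (X := fun x : ℝ => x) (by fun_prop) (hY i) (law i)
      (moments_gammaMeasure ha (inv_pos.2 hl) 4).1
    have hk1 := hk 1
    rw [hM 1] at hk1
    simp only [pow_one] at hk1
    refine ⟨hI4, ?_, ?_, ?_⟩
    · rw [hk1]
      simp only [Finset.prod_range_succ, Finset.prod_range_zero, Nat.cast_zero]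
      field_simp
      ring
    · rw [hk 2, hM]
      simp only [Finset.prod_range_succ, Finset.prod_range_zero, Nat.cast_zero, Nat.cast_one]
      field_simp
      ring
    · rw [integral_sq_varDiscrepancy (hY i) (hτν i) hI4, hk 4, hk 3, hk 2, hk1, hM, hM, hM]
      simp only [Finset.prod_range_succ, Finset.prod_range_zero, Nat.cast_zero, Nat.cast_one,
        Nat.cast_ofNat, zero_div, add_zero, neg_zero, mul_zero, zero_mul]
      field_simp
      ring
  refine ⟨fun i => (α * (α + 1 / c) + 3 * α ^ 3 / c) * (1 + lam i ^ 4),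
    MomentControl.of_moments hY hτ hτν (fun i => (hmom i).1) (fun i => (hmom i).2.1)
    (fun i => ?_) (fun i => ?_) (fun i => ?_), isBigO_sum_const_mul_one_add _ moment⟩
  · rw [(hmom i).2.2.1]
    have := hτ i
    field_simp
    ring
  all_goals
    have hl := lam_pos i
    have ht := hτ i
    have h2 : lam i ^ 2 ≤ 1 + lam i ^ 4 := by nlinarith [sq_nonneg (lam i ^ 2 - 1)]
    have hτ1 : 1 / τ i ≤ 1 / c := one_div_le_one_div_of_le hc (hcτ i)
  · rw [(hmom i).2.2.1]
    have e1 : α * lam i ^ 2 * (α + 1 / τ i) ≤ α * (1 + lam i ^ 4) * (α + 1 / c) := by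
      gcongr
    have e2 : 0 < 3 * α ^ 3 / c * (1 + lam i ^ 4) := by positivity
    linarith
  · rw [(hmom i).2.2.2]
    have e1 : α ^ 3 * lam i ^ 4 * (τ i * α + 3) / (τ i * (τ i * α + 1)) ≤
        3 * α ^ 3 * lam i ^ 4 * (1 / τ i) := by
      rw [mul_one_div, div_le_div_iff₀ (by positivity) ht]
      have : 0 < α ^ 3 * lam i ^ 4 * τ i := by positivity
      have h5 : 0 < τ i * α := by positivity
      nlinarith
    have e3 : 3 * α ^ 3 * lam i ^ 4 * (1 / τ i) ≤ 3 * α ^ 3 * lam i ^ 4 * (1 / c) := by gcongr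
    have e4 : 3 * α ^ 3 / c * (1 + lam i ^ 4) =
        3 * α ^ 3 * lam i ^ 4 * (1 / c) + 3 * α ^ 3 / c := by ring
    have e5 : 0 < 3 * α ^ 3 / c := by positivity
    have e6 : 0 < α * (α + 1 / c) * (1 + lam i ^ 4) := by positivity
    rw [add_mul]
    linarith

/-! ### The Gamma integral along rays and the decay of the Gamma function on vertical lines -/

lemma integrableOn_rpow_mul_exp_neg_mul {a b : ℝ} (ha : 0 < a) (hb : 0 < b) :
    IntegrableOn (fun t : ℝ => t ^ (a - 1) * Real.exp (-(b * t))) (Set.Ioi 0) := by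
  -- A nonintegrable function has integral 0 by convention, so a nonzero value proves integrability.
  refine Integrable.of_integral_ne_zero ?_
  rw [Real.integral_rpow_mul_exp_neg_mul_Ioi ha hb]
  have := Real.Gamma_pos_of_pos ha
  positivity

lemma norm_cpow_mul_cexp_neg_mul (s z : ℂ) {t : ℝ} (ht : 0 < t) :
    ‖(t : ℂ) ^ (s - 1) * Complex.exp (-(z * t))‖ =
      t ^ (s.re - 1) * Real.exp (-(z.re * t)) := by
  rw [norm_mul, Complex.norm_cpow_eq_rpow_re_of_pos ht, Complex.norm_exp]
  simp

lemma continuousOn_cpow_mul_cexp (s z : ℂ) :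
    ContinuousOn (fun t : ℝ => (t : ℂ) ^ (s - 1) * Complex.exp (-(z * t))) (Set.Ioi 0) := by
  refine ContinuousOn.mul (fun t ht => ?_) (by fun_prop)
  exact (Complex.continuous_ofReal.continuousAt.cpow continuousAt_const
    (Or.inl (by simpa using ht))).continuousWithinAt

lemma integrableOn_cpow_mul_cexp_neg_mul {s z : ℂ} (hs : 0 < s.re) (hz : 0 < z.re) :
    IntegrableOn (fun t : ℝ => (t : ℂ) ^ (s - 1) * Complex.exp (-(z * t))) (Set.Ioi 0) := by
  refine (integrableOn_rpow_mul_exp_neg_mul hs hz).mono'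
    ((continuousOn_cpow_mul_cexp s z).aestronglyMeasurable measurableSet_Ioi) ?_
  filter_upwards [ae_restrict_mem measurableSet_Ioi] with t ht
  exact (norm_cpow_mul_cexp_neg_mul s z ht).le

/-- Differentiation under the integral: on the half plane `Re w > Re z / 2` one function dominates
all the derivatives. -/
lemma differentiableAt_integral_cpow_mul_cexp {s z : ℂ} (hs : 0 < s.re) (hz : 0 < z.re) :
    DifferentiableAt ℂ
      (fun w : ℂ => ∫ t : ℝ in Set.Ioi 0, (t : ℂ) ^ (s - 1) * Complex.exp (-(w * t))) z := by
  have hU : {w : ℂ | z.re / 2 < w.re} ∈ 𝓝 z :=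
    (Complex.continuous_re.isOpen_preimage _ isOpen_Ioi).mem_nhds
      (by simpa using half_lt_self hz)
  have hs1 : 0 < (s + 1).re := by simp; linarith
  refine (hasDerivAt_integral_of_dominated_loc_of_deriv_le (μ := volume.restrict (Set.Ioi 0))
    (F := fun w t => (t : ℂ) ^ (s - 1) * Complex.exp (-(w * t)))
    -- The exponent is kept as `s + 1 - 1` so that the norm and continuity lemmas apply with `s + 1`
    -- for `s`.
    (F' := fun w t => -((t : ℂ) ^ (s + 1 - 1) * Complex.exp (-(w * t))))
    (bound := fun t => t ^ ((s + 1).re - 1) * Real.exp (-(z.re / 2 * t)))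
    hU (Eventually.of_forall fun w =>
      (continuousOn_cpow_mul_cexp s w).aestronglyMeasurable measurableSet_Ioi)
    (integrableOn_cpow_mul_cexp_neg_mul hs hz)
    ((continuousOn_cpow_mul_cexp (s + 1) z).aestronglyMeasurable measurableSet_Ioi).neg ?_
    (integrableOn_rpow_mul_exp_neg_mul hs1 (half_pos hz)) ?_).2.differentiableAt
  · filter_upwards [ae_restrict_mem measurableSet_Ioi] with t ht w hw
    have ht' : 0 < t := ht
    rw [norm_neg, norm_cpow_mul_cexp_neg_mul (s + 1) w ht]
    have hw' : z.re / 2 < w.re := hw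
    gcongr
  · filter_upwards [ae_restrict_mem measurableSet_Ioi] with t ht w hw
    have ht0 : (t : ℂ) ≠ 0 := Complex.ofReal_ne_zero.2 (ne_of_gt ht)
    have h1 : HasDerivAt (fun w : ℂ => -(w * t)) (-(1 * (t : ℂ))) w :=
      ((hasDerivAt_id w).mul_const (t : ℂ)).neg
    have h2 := (h1.cexp).const_mul ((t : ℂ) ^ (s - 1))
    have h3 : -((t : ℂ) ^ (s + 1 - 1) * Complex.exp (-(w * t))) =
        (t : ℂ) ^ (s - 1) * (Complex.exp (-(w * t)) * -(1 * (t : ℂ))) := by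
      rw [show s + 1 - 1 = (s - 1) + 1 by ring, Complex.cpow_add _ _ ht0, Complex.cpow_one]
      ring
    rw [h3]
    exact h2

/-- The Gamma integral with a complex scale parameter in the right half plane. -/
lemma integral_cpow_mul_cexp_neg_mul {s z : ℂ} (hs : 0 < s.re) (hz : 0 < z.re) :
    ∫ t : ℝ in Set.Ioi 0, (t : ℂ) ^ (s - 1) * Complex.exp (-(z * t)) =
      z ^ (-s) * Complex.Gamma s := by
  set U : Set ℂ := {w | 0 < w.re} with hU
  have hUo : IsOpen U := Complex.continuous_re.isOpen_preimage _ isOpen_Ioi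
  have hUc : IsPreconnected U := (convex_halfSpace_re_gt 0).isPreconnected
  have hf : AnalyticOnNhd ℂ
      (fun w : ℂ => ∫ t : ℝ in Set.Ioi 0, (t : ℂ) ^ (s - 1) * Complex.exp (-(w * t))) U :=
    DifferentiableOn.analyticOnNhd
      (fun w hw => (differentiableAt_integral_cpow_mul_cexp hs hw).differentiableWithinAt) hUo
  have hg : AnalyticOnNhd ℂ (fun w : ℂ => w ^ (-s) * Complex.Gamma s) U := by
    refine DifferentiableOn.analyticOnNhd (fun w hw => ?_) hUo
    refine DifferentiableAt.differentiableWithinAt ?_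
    refine DifferentiableAt.mul_const ?_ _
    exact differentiableAt_id.cpow_const (Or.inl hw)
  -- Identity theorem: the formula is known for positive real scales, and the points `1 + 1 / (n +
  -- 1)` accumulate at 1.
  refine hf.eqOn_of_preconnected_of_frequently_eq hg hUc (z₀ := 1) (by simp [hU]) ?_ hz
  have hseq : Tendsto (fun n : ℕ => (1 : ℂ) + ((1 / ((n : ℝ) + 1) : ℝ) : ℂ)) atTop (𝓝[≠] 1) := by
    refine tendsto_nhdsWithin_iff.2 ⟨?_, Eventually.of_forall fun n => ?_⟩
    · have h0 : Tendsto (fun n : ℕ => ((1 / ((n : ℝ) + 1) : ℝ) : ℂ)) atTop (𝓝 ((0 : ℝ) : ℂ)) :=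
        (Complex.continuous_ofReal.tendsto 0).comp tendsto_one_div_add_atTop_nhds_zero_nat
      simpa using h0.const_add 1
    · have : (1 / ((n : ℝ) + 1) : ℝ) ≠ 0 := by positivity
      simpa using Complex.ofReal_ne_zero.2 this
  refine hseq.frequently (Eventually.frequently (Eventually.of_forall fun n => ?_))
  have hr : (0 : ℝ) < 1 + 1 / ((n : ℝ) + 1) := by positivity
  have h := Complex.integral_cpow_mul_exp_neg_mul_Ioi hs hr
  have he : (1 : ℂ) + ((1 / ((n : ℝ) + 1) : ℝ) : ℂ) = ((1 + 1 / ((n : ℝ) + 1) : ℝ) : ℂ) := by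
    push_cast; ring
  rw [he, h, one_div, Complex.inv_cpow _ _ (by
    rw [Complex.arg_ofReal_of_nonneg hr.le]; exact Real.pi_pos.ne), Complex.cpow_neg]

/-- The Gamma function decays like `exp (-φ |Im s|)` on vertical lines, for every `φ < π / 2`. -/
lemma norm_Gamma_le {σ φ : ℝ} (hσ : 0 < σ) (hφ : |φ| < Real.pi / 2) (y : ℝ) :
    ‖Complex.Gamma (σ + y * Complex.I)‖ ≤
      (1 / Real.cos φ) ^ σ * Real.Gamma σ * Real.exp (-(φ * y)) := by
  have hcos : 0 < Real.cos φ := Real.cos_pos_of_mem_Ioo (abs_lt.1 hφ)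
  set s : ℂ := σ + y * Complex.I with hs
  have hsre : s.re = σ := by simp [hs]
  have hsim : s.im = y := by simp [hs]
  -- Rotating the ray by `φ` produces the factor `‖z ^ (-s)‖ = exp (φ * y)`, whereas the size of the
  -- integral involves `z` only through `Re z = cos φ`.
  set z : ℂ := Complex.exp (φ * Complex.I) with hz
  have hzre : z.re = Real.cos φ := by rw [hz, Complex.exp_ofReal_mul_I_re]
  have hz0 : z ≠ 0 := Complex.exp_ne_zero _
  have hint := integral_cpow_mul_cexp_neg_mul (s := s) (z := z) (by rwa [hsre]) (by rwa [hzre])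
  have hle : ‖∫ t : ℝ in Set.Ioi 0, (t : ℂ) ^ (s - 1) * Complex.exp (-(z * t))‖ ≤
      (1 / Real.cos φ) ^ σ * Real.Gamma σ := by
    rw [← Real.integral_rpow_mul_exp_neg_mul_Ioi hσ hcos]
    refine (norm_integral_le_integral_norm _).trans (le_of_eq ?_)
    refine setIntegral_congr_fun measurableSet_Ioi fun t ht => ?_
    rw [norm_cpow_mul_cexp_neg_mul s z ht, hsre, hzre]
  have hnz : ‖z ^ (-s)‖ = Real.exp (φ * y) := by
    have harg : Complex.arg z = φ := by
      rw [hz, Complex.arg_exp_mul_I]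
      refine (toIocMod_eq_self _).2 ⟨?_, ?_⟩
      · have := (abs_lt.1 hφ).1; linarith [Real.pi_pos]
      · have := (abs_lt.1 hφ).2; linarith [Real.pi_pos]
    rw [Complex.norm_cpow_of_ne_zero hz0, harg, hz, Complex.norm_exp_ofReal_mul_I, Real.one_rpow,
      Complex.neg_im, hsim, one_div, ← Real.exp_neg]
    congr 1; ring
  rw [hint, norm_mul, hnz] at hle
  rw [Real.exp_neg, ← div_eq_mul_inv, le_div_iff₀ (Real.exp_pos _), mul_comm]
  exact hle

section Normalization

/-! ### The normalization of the generalized hyperbolic secant densities -/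

lemma ofReal_mul_exp_mul_I_cpow {y a : ℝ} (hy : 0 < y) (ha : |a| < Real.pi / 2) (w : ℂ) :
    ((y : ℂ) * Complex.exp (a * Complex.I)) ^ w =
      (y : ℂ) ^ w * Complex.exp (a * Complex.I * w) := by
  have hy0 : (y : ℂ) ≠ 0 := Complex.ofReal_ne_zero.2 hy.ne'
  have h1 := (abs_lt.1 ha).1
  have h2 := (abs_lt.1 ha).2
  have hpi := Real.pi_pos
  have hlog : Complex.log (Complex.exp (a * Complex.I)) = a * Complex.I :=
    Complex.log_exp (by simp; linarith) (by simp; linarith)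
  rw [Complex.cpow_def_of_ne_zero (mul_ne_zero hy0 (Complex.exp_ne_zero _)),
    Complex.log_ofReal_mul hy (Complex.exp_ne_zero _), hlog, Complex.cpow_def_of_ne_zero hy0,
    ← Complex.exp_add, Complex.ofReal_log hy.le]
  congr 1; ring

/-- The function whose Mellin transform is the tilted density of the generalized hyperbolic secant
law. -/
noncomputable def ghsKernel (r a t : ℝ) : ℂ :=
  (Complex.exp (-a * Complex.I) + Complex.exp (a * Complex.I) * t) ^ (-(r : ℂ))

variable {r a : ℝ}

lemma cos_pos_of_abs_lt (ha : |a| < Real.pi / 2) : 0 < Real.cos a :=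
  Real.cos_pos_of_mem_Ioo (abs_lt.1 ha)

lemma re_exp_neg_add_exp_mul (a t : ℝ) :
    (Complex.exp (-a * Complex.I) + Complex.exp (a * Complex.I) * t).re =
      Real.cos a * (1 + t) := by
  rw [Complex.add_re, Complex.re_mul_ofReal, Complex.exp_ofReal_mul_I_re,
    show -(a : ℂ) * Complex.I = ((-a : ℝ) : ℂ) * Complex.I by push_cast; ring,
    Complex.exp_ofReal_mul_I_re, Real.cos_neg]
  ring

lemma norm_ghs_double_kernel (s : ℂ) {t y : ℝ} (ht : 0 < t) (hy : 0 < y) :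
    ‖(t : ℂ) ^ (s - 1) * ((y : ℂ) ^ ((r : ℂ) - 1) * Complex.exp
        (-((Complex.exp (-a * Complex.I) + Complex.exp (a * Complex.I) * t) * y)))‖ =
      (y ^ (r - 1) * Real.exp (-(Real.cos a * y))) *
        (t ^ (s.re - 1) * Real.exp (-(Real.cos a * y * t))) := by
  rw [norm_mul, norm_cpow_mul_cexp_neg_mul _ _ hy, Complex.norm_cpow_eq_rpow_re_of_pos ht,
    re_exp_neg_add_exp_mul,
    show -(Real.cos a * (1 + t) * y) = -(Real.cos a * y) + -(Real.cos a * y * t) by ring,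
    Real.exp_add]
  simp only [Complex.sub_re, Complex.one_re, Complex.ofReal_re]
  ring

/-- Tonelli with `t` first: the inner integral of the norm is a constant times `(cos a * y) ^ (-Re
s)`, which leaves a gamma integral in `y` with exponent `r - Re s > 0`. -/
lemma integrable_ghs_double_kernel (ha : |a| < Real.pi / 2) {s : ℂ} (hs : 0 < s.re)
    (hsr : s.re < r) :
    Integrable (Function.uncurry fun t y : ℝ => (t : ℂ) ^ (s - 1) * ((y : ℂ) ^ ((r : ℂ) - 1) *
      Complex.exp (-((Complex.exp (-a * Complex.I) + Complex.exp (a * Complex.I) * t) * y))))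
      ((volume.restrict (Set.Ioi 0)).prod (volume.restrict (Set.Ioi 0))) := by
  have hcos := cos_pos_of_abs_lt ha
  have hmeas : Measurable (Function.uncurry fun t y : ℝ =>
      (t : ℂ) ^ (s - 1) * ((y : ℂ) ^ ((r : ℂ) - 1) *
      Complex.exp (-((Complex.exp (-a * Complex.I) + Complex.exp (a * Complex.I) * t) * y)))) := by
    unfold Function.uncurry
    fun_prop
  rw [integrable_prod_iff' hmeas.aestronglyMeasurable]
  constructor
  · filter_upwards [ae_restrict_mem measurableSet_Ioi] with y hy
    have hy' : 0 < y := hy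
    refine ((integrableOn_rpow_mul_exp_neg_mul hs (mul_pos hcos hy')).const_mul
      (y ^ (r - 1) * Real.exp (-(Real.cos a * y)))).mono'
      (hmeas.comp measurable_prodMk_right).aestronglyMeasurable ?_
    filter_upwards [ae_restrict_mem measurableSet_Ioi] with t ht
    exact (norm_ghs_double_kernel s ht hy).le
  · have h1 : IntegrableOn (fun y : ℝ => (1 / Real.cos a) ^ s.re * Real.Gamma s.re *
        (y ^ ((r - s.re) - 1) * Real.exp (-(Real.cos a * y)))) (Set.Ioi 0) :=
      (integrableOn_rpow_mul_exp_neg_mul (sub_pos.2 hsr) hcos).const_mul _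
    refine h1.congr ?_
    filter_upwards [ae_restrict_mem measurableSet_Ioi] with y hy
    have hy' : 0 < y := hy
    have h2 : ∫ t in Set.Ioi (0 : ℝ), ‖(t : ℂ) ^ (s - 1) * ((y : ℂ) ^ ((r : ℂ) - 1) *
        Complex.exp (-((Complex.exp (-a * Complex.I) + Complex.exp (a * Complex.I) * t) * y)))‖ =
        ∫ t in Set.Ioi (0 : ℝ), (y ^ (r - 1) * Real.exp (-(Real.cos a * y))) *
          (t ^ (s.re - 1) * Real.exp (-(Real.cos a * y * t))) :=
      setIntegral_congr_fun measurableSet_Ioi fun t ht => norm_ghs_double_kernel s ht hy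
    simp only [Function.uncurry]
    rw [h2, integral_const_mul, Real.integral_rpow_mul_exp_neg_mul_Ioi hs (mul_pos hcos hy'),
      show r - s.re - 1 = (r - 1) - s.re by ring, Real.rpow_sub hy', one_div, one_div, mul_inv,
      Real.mul_rpow (inv_nonneg.2 hcos.le) (inv_nonneg.2 hy'.le), Real.inv_rpow hy'.le]
    ring

lemma integral_ghs_double_kernel (hr : 0 < r) (ha : |a| < Real.pi / 2) (s : ℂ) {t : ℝ}
    (ht : 0 < t) :
    ∫ y in Set.Ioi (0 : ℝ), (t : ℂ) ^ (s - 1) * ((y : ℂ) ^ ((r : ℂ) - 1) *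
      Complex.exp (-((Complex.exp (-a * Complex.I) + Complex.exp (a * Complex.I) * t) * y))) =
      (t : ℂ) ^ (s - 1) * ghsKernel r a t * Complex.Gamma r := by
  have hcos := cos_pos_of_abs_lt ha
  rw [integral_const_mul, integral_cpow_mul_cexp_neg_mul (by simpa using hr)
    (by rw [re_exp_neg_add_exp_mul]; positivity), ghsKernel]
  ring

lemma mellinConvergent_ghsKernel (ha : |a| < Real.pi / 2) {s : ℂ} (hs : 0 < s.re)
    (hsr : s.re < r) : MellinConvergent (ghsKernel r a) s := by
  have hr : 0 < r := hs.trans hsr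
  have h := (integrable_ghs_double_kernel ha hs hsr).integral_prod_left
  have hG : Complex.Gamma r ≠ 0 := Complex.Gamma_ne_zero_of_re_pos (by simpa using hr)
  refine (h.mul_const (Complex.Gamma r)⁻¹).congr ?_
  filter_upwards [ae_restrict_mem measurableSet_Ioi] with t ht
  simp only [Function.uncurry]
  rw [integral_ghs_double_kernel hr ha s ht, mul_inv_cancel_right₀ hG, smul_eq_mul]

/-- The double integral is evaluated in both orders. Integrating over `y` first gives the kernel
times `Γ(r)`; over `t` first, two gamma integrals along rays. -/
lemma mellin_ghsKernel (ha : |a| < Real.pi / 2) {s : ℂ} (hs : 0 < s.re) (hsr : s.re < r) :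
    mellin (ghsKernel r a) s * Complex.Gamma r =
      Complex.Gamma s * Complex.Gamma (r - s) * Complex.exp (a * Complex.I * (r - 2 * s)) := by
  have hr : 0 < r := hs.trans hsr
  have hcos := cos_pos_of_abs_lt ha
  have hna : |-a| < Real.pi / 2 := by rwa [abs_neg]
  have hswap := integral_integral_swap (integrable_ghs_double_kernel ha hs hsr)
  have h1 : ∫ t in Set.Ioi (0 : ℝ), ∫ y in Set.Ioi (0 : ℝ),
      (t : ℂ) ^ (s - 1) * ((y : ℂ) ^ ((r : ℂ) - 1) *
      Complex.exp (-((Complex.exp (-a * Complex.I) + Complex.exp (a * Complex.I) * t) * y))) =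
      mellin (ghsKernel r a) s * Complex.Gamma r := by
    rw [mellin, ← integral_mul_const]
    exact setIntegral_congr_fun measurableSet_Ioi fun t ht =>
      integral_ghs_double_kernel hr ha s ht
  -- The factor 1 and the angle `-a` put the remaining rate in polar form, ready for
  -- `ofReal_mul_exp_mul_I_cpow`.
  have h2 : ∫ y in Set.Ioi (0 : ℝ), ∫ t in Set.Ioi (0 : ℝ),
      (t : ℂ) ^ (s - 1) * ((y : ℂ) ^ ((r : ℂ) - 1) *
      Complex.exp (-((Complex.exp (-a * Complex.I) + Complex.exp (a * Complex.I) * t) * y))) =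
      ∫ y in Set.Ioi (0 : ℝ), (Complex.Gamma s * Complex.exp (a * Complex.I * -s)) *
        ((y : ℂ) ^ (((r : ℂ) - s) - 1) *
          Complex.exp (-(((1 : ℝ) : ℂ) * Complex.exp ((-a : ℝ) * Complex.I) * y))) := by
    refine setIntegral_congr_fun measurableSet_Ioi fun y hy => ?_
    have hy' : 0 < y := hy
    have hy0 : (y : ℂ) ≠ 0 := Complex.ofReal_ne_zero.2 hy'.ne'
    have e1 : ∀ t : ℝ, (t : ℂ) ^ (s - 1) * ((y : ℂ) ^ ((r : ℂ) - 1) *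
        Complex.exp (-((Complex.exp (-a * Complex.I) + Complex.exp (a * Complex.I) * t) * y))) =
        ((y : ℂ) ^ ((r : ℂ) - 1) * Complex.exp (-(Complex.exp (-a * Complex.I) * y))) *
          ((t : ℂ) ^ (s - 1) *
            Complex.exp (-((y * Complex.exp (a * Complex.I)) * t))) := by
      intro t
      rw [show -((Complex.exp (-a * Complex.I) + Complex.exp (a * Complex.I) * t) * (y : ℂ)) =
        -(Complex.exp (-a * Complex.I) * y) + -((y * Complex.exp (a * Complex.I)) * t) by ring,
        Complex.exp_add]
      ring
    simp only [e1]
    rw [integral_const_mul, integral_cpow_mul_cexp_neg_mul hs (by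
      rw [Complex.re_ofReal_mul, Complex.exp_ofReal_mul_I_re]; positivity),
      ofReal_mul_exp_mul_I_cpow hy' ha, show (r : ℂ) - s - 1 = (r - 1) + -s by ring,
      Complex.cpow_add _ _ hy0]
    push_cast
    rw [one_mul]
    ring
  rw [← h1, hswap, h2, integral_const_mul, integral_cpow_mul_cexp_neg_mul (by simpa using hsr) (by
      rw [Complex.re_ofReal_mul, Complex.exp_ofReal_mul_I_re, Real.cos_neg]; positivity),
    ofReal_mul_exp_mul_I_cpow zero_lt_one hna, Complex.ofReal_one, Complex.one_cpow, one_mul,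
    show (a : ℂ) * Complex.I * (r - 2 * s) =
      a * Complex.I * -s + (-a : ℝ) * Complex.I * -(r - s) by push_cast; ring, Complex.exp_add]
  ring

lemma integrable_exp_neg_mul_abs {b : ℝ} (hb : 0 < b) :
    Integrable fun y : ℝ => Real.exp (-(b * |y|)) := by
  rw [← integrableOn_univ, ← Set.Iic_union_Ioi (a := (0 : ℝ))]
  refine IntegrableOn.union ?_ ?_
  · refine (integrableOn_exp_mul_Iic hb 0).congr_fun (fun y hy => ?_) measurableSet_Iic
    simp only [abs_of_nonpos (show y ≤ 0 from hy), mul_neg, neg_neg]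
  · refine (exp_neg_integrableOn_Ioi 0 hb).congr_fun (fun y hy => ?_) measurableSet_Ioi
    simp only [abs_of_pos (show (0 : ℝ) < y from hy), neg_mul]

lemma continuous_Gamma_vertical {σ : ℝ} (hσ : 0 < σ) :
    Continuous fun y : ℝ => Complex.Gamma (σ + y * Complex.I) := by
  refine continuous_iff_continuousAt.2 fun y => ?_
  have h : ContinuousAt Complex.Gamma (σ + y * Complex.I) :=
    (Complex.differentiableAt_Gamma _ fun m hm => by
      have := congrArg Complex.re hm
      simp at this
      have : (0 : ℝ) ≤ m := Nat.cast_nonneg m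
      linarith).continuousAt
  exact ContinuousAt.comp (f := fun y : ℝ => (σ : ℂ) + y * Complex.I) h (by fun_prop)

lemma integrable_sq_norm_Gamma_mul_exp {σ : ℝ} (hσ : 0 < σ) (ha : |a| < Real.pi / 2) :
    Integrable fun y : ℝ =>
      ‖Complex.Gamma (σ + y * Complex.I)‖ ^ 2 * Real.exp (2 * a * y) := by
  -- The decay `exp (-2 * φ * |y|)` of the squared Gamma factor then beats the growth `exp (2 * |a|
  -- * |y|)`.
  obtain ⟨φ, h1, h2⟩ := exists_between ha
  have hφ0 : 0 < φ := (abs_nonneg a).trans_lt h1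
  have hφ : |φ| < Real.pi / 2 := by rwa [abs_of_pos hφ0]
  have hφ' : |-φ| < Real.pi / 2 := by rwa [abs_neg]
  set C := (1 / Real.cos φ) ^ σ * Real.Gamma σ with hC
  have hC0 : 0 ≤ C := by
    have := cos_pos_of_abs_lt hφ
    have := Real.Gamma_pos_of_pos hσ
    positivity
  have hle : ∀ y : ℝ, ‖Complex.Gamma (σ + y * Complex.I)‖ ≤ C * Real.exp (-(φ * |y|)) := by
    intro y
    rcases le_total 0 y with hy | hy
    · rw [abs_of_nonneg hy]
      exact norm_Gamma_le hσ hφ y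
    · rw [abs_of_nonpos hy]
      have := norm_Gamma_le hσ hφ' y
      rwa [Real.cos_neg, show -(-φ * y) = -(φ * -y) by ring] at this
  have hb : 0 < 2 * (φ - |a|) := by linarith
  refine ((integrable_exp_neg_mul_abs hb).const_mul (C ^ 2)).mono' ?_
    (Eventually.of_forall fun y => ?_)
  · have := continuous_Gamma_vertical hσ
    exact (Continuous.mul (this.norm.pow 2) (by fun_prop)).aestronglyMeasurable
  · have hay : 2 * a * y ≤ 2 * (|a| * |y|) := by
      rw [← abs_mul, mul_assoc]
      linarith [le_abs_self (a * y)]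
    rw [Real.norm_of_nonneg (by positivity)]
    calc _ ≤ (C * Real.exp (-(φ * |y|))) ^ 2 * Real.exp (2 * (|a| * |y|)) := by
          gcongr
          exact hle y
      _ = _ := by
          rw [mul_pow, mul_assoc, ← Real.exp_nat_mul, ← Real.exp_add]
          congr 2
          push_cast
          ring

/-- On the line `Re s = r / 2` the point `r - s` is the conjugate of `s`, so the two Gamma factors
multiply to a squared norm and the exponential becomes real. -/
lemma mellin_ghsKernel_vertical (hr : 0 < r) (ha : |a| < Real.pi / 2) (y : ℝ) :
    mellin (ghsKernel r a) ((r / 2 : ℝ) + y * Complex.I) =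
      ((‖Complex.Gamma ((r / 2 : ℝ) + y * Complex.I)‖ ^ 2 * Real.exp (2 * a * y) /
        Real.Gamma r : ℝ) : ℂ) := by
  set s : ℂ := (r / 2 : ℝ) + y * Complex.I with hs
  have hre : s.re = r / 2 := by simp [hs]
  have h := mellin_ghsKernel ha (s := s) (r := r) (by rw [hre]; positivity)
    (by rw [hre]; exact half_lt_self hr)
  have hconj : (r : ℂ) - s = (starRingEnd ℂ) s := by
    rw [hs]
    simp only [map_add, map_mul, Complex.conj_ofReal, Complex.conj_I]
    push_cast
    ring
  have hexp : (a : ℂ) * Complex.I * (r - 2 * s) = ((2 * a * y : ℝ) : ℂ) := by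
    rw [hs]
    push_cast
    linear_combination (-2 * (a : ℂ) * y) * Complex.I_sq
  have hG : (Real.Gamma r : ℂ) ≠ 0 := Complex.ofReal_ne_zero.2 (Real.Gamma_pos_of_pos hr).ne'
  rw [hconj, Complex.Gamma_conj, Complex.mul_conj, Complex.normSq_eq_norm_sq, hexp,
    ← Complex.ofReal_exp, Complex.Gamma_ofReal, ← eq_div_iff hG] at h
  rw [h]
  push_cast
  ring

lemma ghsKernel_one (ha : |a| < Real.pi / 2) :
    ghsKernel r a 1 = (((2 * Real.cos a) ^ (-r) : ℝ) : ℂ) := by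
  have hcos := cos_pos_of_abs_lt ha
  have h : Complex.exp (-a * Complex.I) + Complex.exp (a * Complex.I) * ((1 : ℝ) : ℂ) =
      ((2 * Real.cos a : ℝ) : ℂ) := by
    push_cast
    rw [Complex.two_cos]
    ring
  rw [ghsKernel, h, Complex.ofReal_cpow (by positivity)]
  push_cast
  rfl

lemma continuousAt_ghsKernel_one (ha : |a| < Real.pi / 2) : ContinuousAt (ghsKernel r a) 1 := by
  unfold ghsKernel
  refine ContinuousAt.cpow (by fun_prop) continuousAt_const (Or.inl ?_)
  rw [re_exp_neg_add_exp_mul]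
  have := cos_pos_of_abs_lt ha
  positivity

/-- The exponential moments of `|Γ(r / 2 + i y)| ^ 2`. -/
lemma integral_sq_norm_Gamma_mul_exp (hr : 0 < r) (ha : |a| < Real.pi / 2) :
    ∫ y : ℝ, ‖Complex.Gamma ((r / 2 : ℝ) + y * Complex.I)‖ ^ 2 * Real.exp (2 * a * y) =
      2 * Real.pi * Real.Gamma r * (2 * Real.cos a) ^ (-r) := by
  have hr2 : 0 < r / 2 := half_pos hr
  have hconv : MellinConvergent (ghsKernel r a) ((r / 2 : ℝ) : ℂ) :=
    mellinConvergent_ghsKernel ha (by simpa using hr2) (by simpa using half_lt_self hr)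
  have hvert : Complex.VerticalIntegrable (mellin (ghsKernel r a)) (r / 2) := by
    unfold Complex.VerticalIntegrable
    simp only [mellin_ghsKernel_vertical hr ha]
    exact ((integrable_sq_norm_Gamma_mul_exp hr2 ha).div_const _).ofReal
  -- Inversion at the point 1, where the oscillating power is trivial and the kernel equals `(2 *
  -- cos a) ^ (-r)`.
  have h := mellinInv_mellin_eq (r / 2) (ghsKernel r a) zero_lt_one hconv hvert
    (continuousAt_ghsKernel_one ha)
  rw [mellinInv, ghsKernel_one ha] at h
  simp only [mellin_ghsKernel_vertical hr ha, Complex.ofReal_one, Complex.one_cpow, one_smul] at h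
  rw [integral_complex_ofReal, integral_div, Complex.real_smul, ← Complex.ofReal_mul,
    Complex.ofReal_inj] at h
  have hG := (Real.Gamma_pos_of_pos hr).ne'
  have hpi := Real.pi_pos.ne'
  rw [← h]
  generalize ∫ y : ℝ, ‖Complex.Gamma ((r / 2 : ℝ) + y * Complex.I)‖ ^ 2 * Real.exp (2 * a * y) = J
  field_simp

end Normalization

section Moments

/-! ### Moments of the generalized hyperbolic secant laws -/

variable {r : ℝ}

lemma ghs_argument (r x : ℝ) : ((r : ℂ) + (x : ℂ) * Complex.I) / 2 =
    ((r / 2 : ℝ) : ℂ) + ((x / 2 : ℝ) : ℂ) * Complex.I := by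
  push_cast; ring

lemma ghsDensity_nonneg (hr : 0 < r) (l x : ℝ) : 0 ≤ ghsDensity r l x := by
  unfold ghsDensity
  have := Real.Gamma_pos_of_pos hr
  positivity

lemma measurable_ghsDensity (hr : 0 < r) (l : ℝ) : Measurable (ghsDensity r l) := by
  unfold ghsDensity
  simp only [ghs_argument]
  have h := (continuous_Gamma_vertical (half_pos hr)).measurable
  have h1 : Measurable fun x : ℝ =>
      Complex.Gamma (((r / 2 : ℝ) : ℂ) + ((x / 2 : ℝ) : ℂ) * Complex.I) :=
    h.comp (measurable_id.div_const 2)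
  fun_prop

lemma ghsDensity_eq_mul (r l x : ℝ) : ghsDensity r l x =
    (1 + l ^ 2) ^ (-r / 2) * (Real.exp (Real.arctan l * x) * ghsDensity r 0 x) := by
  unfold ghsDensity
  simp [mul_comm x]
  ring

lemma exp_mul_ghsDensity_zero (r a x : ℝ) : Real.exp (a * x) * ghsDensity r 0 x =
    (2 : ℝ) ^ (r - 2) / (Real.pi * Real.Gamma r) *
      (‖Complex.Gamma (((r / 2 : ℝ) : ℂ) + ((2⁻¹ * x : ℝ) : ℂ) * Complex.I)‖ ^ 2 *
        Real.exp (2 * a * (2⁻¹ * x))) := by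
  unfold ghsDensity
  rw [ghs_argument, div_eq_inv_mul x 2, show 2 * a * (2⁻¹ * x) = a * x by ring]
  simp
  ring

lemma integrable_exp_mul_ghsDensity_zero (hr : 0 < r) {a : ℝ} (ha : |a| < Real.pi / 2) :
    Integrable fun x => Real.exp (a * x) * ghsDensity r 0 x := by
  simp only [exp_mul_ghsDensity_zero]
  exact ((integrable_sq_norm_Gamma_mul_exp (half_pos hr) ha).comp_mul_left'
    (by norm_num : (2⁻¹ : ℝ) ≠ 0)).const_mul _

lemma integral_exp_mul_ghsDensity_zero (hr : 0 < r) {a : ℝ} (ha : |a| < Real.pi / 2) :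
    ∫ x, Real.exp (a * x) * ghsDensity r 0 x = Real.cos a ^ (-r) := by
  simp only [exp_mul_ghsDensity_zero]
  have hcos := cos_pos_of_abs_lt ha
  rw [integral_const_mul, Measure.integral_comp_mul_left (fun y : ℝ =>
    ‖Complex.Gamma (((r / 2 : ℝ) : ℂ) + (y : ℂ) * Complex.I)‖ ^ 2 * Real.exp (2 * a * y)),
    integral_sq_norm_Gamma_mul_exp hr ha, Real.mul_rpow zero_le_two hcos.le,
    Real.rpow_neg zero_le_two, Real.rpow_sub zero_lt_two]
  have hG := (Real.Gamma_pos_of_pos hr).ne'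
  have hpi := Real.pi_pos.ne'
  have h2 : (2 : ℝ) ^ r ≠ 0 := (Real.rpow_pos_of_pos zero_lt_two r).ne'
  simp only [inv_inv, abs_two, smul_eq_mul, Real.rpow_two]
  field_simp

lemma integrable_ghsMeasure_iff (hr : 0 < r) (l : ℝ) (f : ℝ → ℝ) :
    Integrable f (ghsMeasure r l) ↔ Integrable fun x => f x * ghsDensity r l x := by
  rw [ghsMeasure, integrable_withDensity_iff (measurable_ghsDensity hr l).ennreal_ofReal
    (Eventually.of_forall fun _ => ENNReal.ofReal_lt_top)]
  simp only [ENNReal.toReal_ofReal (ghsDensity_nonneg hr l _)]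

lemma integral_ghsMeasure (hr : 0 < r) (l : ℝ) (f : ℝ → ℝ) :
    ∫ x, f x ∂(ghsMeasure r l) = ∫ x, f x * ghsDensity r l x := by
  rw [ghsMeasure, integral_withDensity_eq_integral_toReal_smul
    (measurable_ghsDensity hr l).ennreal_ofReal
    (Eventually.of_forall fun _ => ENNReal.ofReal_lt_top)]
  simp only [ENNReal.toReal_ofReal (ghsDensity_nonneg hr l _), smul_eq_mul, mul_comm]

lemma mem_interior_integrableExpSet_ghs (hr : 0 < r) {a : ℝ} (ha : |a| < Real.pi / 2) :
    a ∈ interior (integrableExpSet id (ghsMeasure r 0)) := by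
  refine interior_maximal (s := integrableExpSet id (ghsMeasure r 0))
    (t := Set.Ioo (-(Real.pi / 2)) (Real.pi / 2)) (fun b hb => ?_) isOpen_Ioo (abs_lt.1 ha)
  have := (integrable_ghsMeasure_iff hr 0 fun x => Real.exp (b * x)).2
    (integrable_exp_mul_ghsDensity_zero hr (abs_lt.2 hb))
  exact this

/-- Differentiating an exponential moment of the central law in the tilting parameter. -/
lemma ghs_moment_succ (hr : 0 < r) {k : ℕ} {Q Q' : ℝ → ℝ} (hQ : ∀ x, HasDerivAt Q (Q' x) x)
    (hk : ∀ a, |a| < Real.pi / 2 → ∫ x, x ^ k * Real.exp (a * x) ∂(ghsMeasure r 0) =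
      Q (Real.tan a) * Real.cos a ^ (-r)) {a : ℝ} (ha : |a| < Real.pi / 2) :
    ∫ x, x ^ (k + 1) * Real.exp (a * x) ∂(ghsMeasure r 0) =
      (Q' (Real.tan a) * (1 + Real.tan a ^ 2) + r * Real.tan a * Q (Real.tan a)) *
        Real.cos a ^ (-r) := by
  have hcos := cos_pos_of_abs_lt ha
  have h1 : HasDerivAt (fun b => ∫ x, x ^ k * Real.exp (b * x) ∂(ghsMeasure r 0))
      (∫ x, x ^ (k + 1) * Real.exp (a * x) ∂(ghsMeasure r 0)) a :=
    hasDerivAt_integral_pow_mul_exp_real (mem_interior_integrableExpSet_ghs hr ha) k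
  have h2 : HasDerivAt (fun b => Q (Real.tan b) * Real.cos b ^ (-r))
      (Q' (Real.tan a) * (1 / Real.cos a ^ 2) * Real.cos a ^ (-r) +
        Q (Real.tan a) * (-Real.sin a * -r * Real.cos a ^ (-r - 1))) a :=
    ((hQ (Real.tan a)).comp a (Real.hasDerivAt_tan hcos.ne')).mul
      ((Real.hasDerivAt_cos a).rpow_const (Or.inl hcos.ne'))
  have h3 : (fun b => ∫ x, x ^ k * Real.exp (b * x) ∂(ghsMeasure r 0)) =ᶠ[𝓝 a]
      fun b => Q (Real.tan b) * Real.cos b ^ (-r) := by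
    filter_upwards [isOpen_Ioo.mem_nhds (show a ∈ Set.Ioo _ _ from abs_lt.1 ha)] with b hb
    exact hk b (abs_lt.2 hb)
  rw [h1.unique (h2.congr_of_eventuallyEq h3), ← Real.inv_one_add_tan_sq hcos.ne',
    Real.rpow_sub_one hcos.ne', Real.tan_eq_sin_div_cos]
  field_simp

/-- Each moment is a polynomial in `t = tan a` times `cos a ^ (-r)`, and one more power of `x` maps
`Q` to `(1 + t^2) * Q' + r * t * Q`. This map is applied four times to `Q = 1`. -/
lemma integral_pow_mul_exp_ghs (hr : 0 < r) {a : ℝ} (ha : |a| < Real.pi / 2) :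
    ∫ x, x ^ 1 * Real.exp (a * x) ∂(ghsMeasure r 0) = r * Real.tan a * Real.cos a ^ (-r) ∧
    ∫ x, x ^ 2 * Real.exp (a * x) ∂(ghsMeasure r 0) =
      (r + (r + r ^ 2) * Real.tan a ^ 2) * Real.cos a ^ (-r) ∧
    ∫ x, x ^ 3 * Real.exp (a * x) ∂(ghsMeasure r 0) =
      ((2 * r + 3 * r ^ 2) * Real.tan a + (2 * r + 3 * r ^ 2 + r ^ 3) * Real.tan a ^ 3) *
        Real.cos a ^ (-r) ∧
    ∫ x, x ^ 4 * Real.exp (a * x) ∂(ghsMeasure r 0) =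
      (2 * r + 3 * r ^ 2 + (8 * r + 14 * r ^ 2 + 6 * r ^ 3) * Real.tan a ^ 2 +
        (6 * r + 11 * r ^ 2 + 6 * r ^ 3 + r ^ 4) * Real.tan a ^ 4) * Real.cos a ^ (-r) := by
  have m0 : ∀ a, |a| < Real.pi / 2 → ∫ x, x ^ 0 * Real.exp (a * x) ∂(ghsMeasure r 0) =
      (fun _ => 1) (Real.tan a) * Real.cos a ^ (-r) := fun a ha => by
    rw [integral_ghsMeasure hr]
    simp only [pow_zero, one_mul]
    exact integral_exp_mul_ghsDensity_zero hr ha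
  have m1 : ∀ a, |a| < Real.pi / 2 → ∫ x, x ^ 1 * Real.exp (a * x) ∂(ghsMeasure r 0) =
      (fun t => r * t) (Real.tan a) * Real.cos a ^ (-r) := fun a ha => by
    rw [ghs_moment_succ hr (Q' := fun _ => 0) (fun x => hasDerivAt_const x 1) m0 ha]
    ring
  have m2 : ∀ a, |a| < Real.pi / 2 → ∫ x, x ^ 2 * Real.exp (a * x) ∂(ghsMeasure r 0) =
      (fun t => r + (r + r ^ 2) * t ^ 2) (Real.tan a) * Real.cos a ^ (-r) := fun a ha => by
    rw [ghs_moment_succ hr (Q' := fun _ => r)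
      (fun x => by simpa using (hasDerivAt_id x).const_mul r) m1 ha]
    ring
  have m3 : ∀ a, |a| < Real.pi / 2 → ∫ x, x ^ 3 * Real.exp (a * x) ∂(ghsMeasure r 0) =
      (fun t => (2 * r + 3 * r ^ 2) * t + (2 * r + 3 * r ^ 2 + r ^ 3) * t ^ 3) (Real.tan a) *
        Real.cos a ^ (-r) := fun a ha => by
    rw [ghs_moment_succ hr (Q := fun t => r + (r + r ^ 2) * t ^ 2)
      (Q' := fun t => (r + r ^ 2) * (2 * t)) (fun x => by
        simpa using ((hasDerivAt_pow 2 x).const_mul (r + r ^ 2)).const_add r) m2 ha]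
    ring
  refine ⟨m1 a ha, m2 a ha, m3 a ha, ?_⟩
  rw [ghs_moment_succ hr
    (Q := fun t => (2 * r + 3 * r ^ 2) * t + (2 * r + 3 * r ^ 2 + r ^ 3) * t ^ 3)
    (Q' := fun t => (2 * r + 3 * r ^ 2) * 1 + (2 * r + 3 * r ^ 2 + r ^ 3) * (3 * t ^ 2))
    (fun x => ((hasDerivAt_id x).const_mul _).add
      (by simpa using (hasDerivAt_pow 3 x).const_mul (2 * r + 3 * r ^ 2 + r ^ 3))) m3 ha]
  ring

lemma abs_arctan_lt (l : ℝ) : |Real.arctan l| < Real.pi / 2 :=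
  abs_lt.2 ⟨Real.neg_pi_div_two_lt_arctan l, Real.arctan_lt_pi_div_two l⟩

lemma integrable_pow_four_ghsMeasure (hr : 0 < r) (l : ℝ) :
    Integrable (fun x : ℝ => x ^ 4) (ghsMeasure r l) := by
  have h : Integrable (fun x : ℝ => x ^ 4 * Real.exp (Real.arctan l * x)) (ghsMeasure r 0) :=
    integrable_pow_mul_exp_of_mem_interior_integrableExpSet (X := id)
      (mem_interior_integrableExpSet_ghs hr (abs_arctan_lt l)) 4
  rw [integrable_ghsMeasure_iff hr] at h ⊢
  refine (h.const_mul ((1 + l ^ 2) ^ (-r / 2))).congr (Eventually.of_forall fun x => ?_)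
  simp only
  rw [ghsDensity_eq_mul r l]
  ring

lemma integral_pow_ghsMeasure (hr : 0 < r) (l : ℝ) (k : ℕ) :
    ∫ x, x ^ k ∂(ghsMeasure r l) = (1 + l ^ 2) ^ (-r / 2) *
      ∫ x, x ^ k * Real.exp (Real.arctan l * x) ∂(ghsMeasure r 0) := by
  rw [integral_ghsMeasure hr, integral_ghsMeasure hr, ← integral_const_mul]
  refine integral_congr_ae (Eventually.of_forall fun x => ?_)
  simp only
  rw [ghsDensity_eq_mul r l]
  ring

/-- Since `cos (arctan l) = (1 + l^2) ^ (-1/2)`, the normalizing factor of the density cancels the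
generating function at the tilt `arctan l`. -/
lemma tilt_normalization (r l : ℝ) :
    (1 + l ^ 2) ^ (-r / 2) * Real.cos (Real.arctan l) ^ (-r) = 1 := by
  have h : (0 : ℝ) < 1 + l ^ 2 := by positivity
  rw [Real.cos_arctan, Real.sqrt_eq_rpow, one_div, Real.inv_rpow (by positivity),
    ← Real.rpow_mul h.le, ← Real.rpow_neg h.le, ← Real.rpow_add h]
  rw [show -r / 2 + -(1 / 2 * -r) = 0 by ring, Real.rpow_zero]

/-- The first four moments of the generalized hyperbolic secant law. -/
lemma moments_ghsMeasure (hr : 0 < r) (l : ℝ) :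
    ∫ x, x ^ 1 ∂(ghsMeasure r l) = r * l ∧
    ∫ x, x ^ 2 ∂(ghsMeasure r l) = r + (r + r ^ 2) * l ^ 2 ∧
    ∫ x, x ^ 3 ∂(ghsMeasure r l) =
      (2 * r + 3 * r ^ 2) * l + (2 * r + 3 * r ^ 2 + r ^ 3) * l ^ 3 ∧
    ∫ x, x ^ 4 ∂(ghsMeasure r l) =
      2 * r + 3 * r ^ 2 + (8 * r + 14 * r ^ 2 + 6 * r ^ 3) * l ^ 2 +
        (6 * r + 11 * r ^ 2 + 6 * r ^ 3 + r ^ 4) * l ^ 4 := by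
  obtain ⟨h1, h2, h3, h4⟩ := integral_pow_mul_exp_ghs hr (abs_arctan_lt l)
  have hn := tilt_normalization r l
  rw [Real.tan_arctan] at h1 h2 h3 h4
  simp only [integral_pow_ghsMeasure hr]
  rw [h1, h2, h3, h4]
  refine ⟨?_, ?_, ?_, ?_⟩ <;> rw [mul_left_comm, hn, mul_one]

end Moments

/-! ### Generalized hyperbolic secant observations -/

/-- The second moment of the discrepancy is at most `10 * α^3 * (1 + lam^4) / τ`; the remaining part
of `v` covers the observation itself. -/
lemma exists_momentControl_ghs {Y : ℕ → Ω → ℝ} (hY : ∀ i, Measurable (Y i)) (α : ℝ)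
    (α_pos : 0 < α) (τ lam : ℕ → ℝ)
    (law : ∀ i, P.map (Y i) = (ghsMeasure (τ i * α) (lam i)).map (fun x : ℝ => x / τ i))
    (inf_tau : ∃ c : ℝ, 0 < c ∧ ∀ i, c ≤ τ i)
    (moment : (fun p : ℕ => ∑ i ∈ Finset.range p, lam i ^ 4)
      =O[atTop] (fun p : ℕ => (p : ℝ))) :
    ∃ v : ℕ → ℝ, MomentControl P Y α 0 (1 / α) τ (fun i => α * lam i) v ∧
      (fun p : ℕ => ∑ i ∈ Finset.range p, v i) =O[atTop] (fun p : ℕ => (p : ℝ)) := by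
  obtain ⟨c, hc, hcτ⟩ := inf_tau
  have hτ : ∀ i, 0 < τ i := fun i => hc.trans_le (hcτ i)
  have hτν : ∀ i, 0 < τ i + 1 / α := fun i => by have := hτ i; positivity
  have hmom : ∀ i, Integrable (fun ω => Y i ω ^ 4) P ∧ ∫ ω, Y i ω ∂P = α * lam i ∧
      ∫ ω, Y i ω ^ 2 ∂P = α ^ 2 * lam i ^ 2 + α * (1 + lam i ^ 2) * (1 / τ i) ∧
      ∫ ω, varDiscrepancy α 0 (1 / α) (τ i) (α * lam i) (Y i ω) ^ 2 ∂P =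
        α ^ 3 * (2 + (τ i * α + 5) * lam i ^ 2 + (τ i * α + 3) * lam i ^ 4) /
          (τ i * (τ i * α + 1)) := by
    intro i
    have ha : 0 < τ i * α := mul_pos (hτ i) α_pos
    have ht := hτ i
    obtain ⟨m1, m2, m3, m4⟩ := moments_ghsMeasure ha (lam i)
    obtain ⟨hI4, hk⟩ := moments_of_law (X := fun x : ℝ => x) (by fun_prop) (hY i) (law i)
      (integrable_pow_four_ghsMeasure ha (lam i))
    have hk1 := hk 1
    rw [m1] at hk1
    simp only [pow_one] at hk1
    refine ⟨hI4, ?_, ?_, ?_⟩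
    · rw [hk1]
      field_simp
    · rw [hk 2, m2]
      field_simp
      ring
    · rw [integral_sq_varDiscrepancy (hY i) (hτν i) hI4, hk 4, hk 3, hk 2, hk1, m2, m3, m4]
      field_simp
      ring
  refine ⟨fun i => (α ^ 2 + 2 * (α * (1 / c)) + 10 * (α ^ 3 * (1 / c))) * (1 + lam i ^ 4),
    MomentControl.of_moments hY hτ hτν (fun i => (hmom i).1) (fun i => (hmom i).2.1)
    (fun i => ?_) (fun i => ?_) (fun i => ?_), isBigO_sum_const_mul_one_add _ moment⟩
  · rw [(hmom i).2.2.1]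
    have := hτ i
    field_simp
    ring
  all_goals
    have ht := hτ i
    have h4 : 0 ≤ lam i ^ 4 := by positivity
    have h2 : lam i ^ 2 ≤ 1 + lam i ^ 4 := by nlinarith [sq_nonneg (lam i ^ 2 - 1)]
    have hτ1 : 1 / τ i ≤ 1 / c := one_div_le_one_div_of_le hc (hcτ i)
    have p1 : 0 < α ^ 2 * (1 + lam i ^ 4) := by positivity
    have p2 : 0 < α * (1 / c) * (1 + lam i ^ 4) := by positivity
    have p3 : 0 < α ^ 3 * (1 / c) * (1 + lam i ^ 4) := by positivity
  · rw [(hmom i).2.2.1]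
    have e1 : α ^ 2 * lam i ^ 2 ≤ α ^ 2 * (1 + lam i ^ 4) := by gcongr
    have e2 : α * (1 + lam i ^ 2) * (1 / τ i) ≤ α * (2 * (1 + lam i ^ 4)) * (1 / c) := by
      gcongr
      linarith
    linarith
  · rw [(hmom i).2.2.2]
    have h5 : 0 < τ i * α := mul_pos ht α_pos
    have e1 : 2 + (τ i * α + 5) * lam i ^ 2 + (τ i * α + 3) * lam i ^ 4 ≤
        10 * (1 + lam i ^ 4) * (τ i * α + 1) := by
      have := mul_le_mul_of_nonneg_left h2 (show 0 ≤ τ i * α + 5 by positivity)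
      have : 0 ≤ τ i * α * lam i ^ 4 := by positivity
      nlinarith
    have e2 : α ^ 3 * (2 + (τ i * α + 5) * lam i ^ 2 + (τ i * α + 3) * lam i ^ 4) /
        (τ i * (τ i * α + 1)) ≤ α ^ 3 * (10 * (1 + lam i ^ 4)) * (1 / τ i) := by
      rw [mul_one_div, div_le_div_iff₀ (by positivity) ht]
      calc _ ≤ α ^ 3 * (10 * (1 + lam i ^ 4) * (τ i * α + 1)) * τ i := by gcongr
        _ = _ := by ring
    have e3 : α ^ 3 * (10 * (1 + lam i ^ 4)) * (1 / τ i) ≤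
        α ^ 3 * (10 * (1 + lam i ^ 4)) * (1 / c) := by gcongr
    linarith

/-! ### The five families together -/

lemma NEFQVFModel.exists_momentControl {Y : ℕ → Ω → ℝ} (hY : ∀ i, Measurable (Y i))
    {ν₀ ν₁ ν₂ : ℝ} {τ θ : ℕ → ℝ} (h : NEFQVFModel P Y ν₀ ν₁ ν₂ τ θ) :
    ∃ v : ℕ → ℝ, MomentControl P Y ν₀ ν₁ ν₂ τ θ v ∧
      (fun p : ℕ => ∑ i ∈ Finset.range p, v i) =O[atTop] (fun p : ℕ => (p : ℝ)) := by
  cases h with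
  | binomial n q law two_le => exact exists_momentControl_binomial hY n q law two_le
  | poisson τ θ law inf_tau inf_rate moment =>
    exact exists_momentControl_poisson hY _ _ law inf_tau inf_rate moment
  | negBinomial n q n_pos q_mem law inf_rate moment =>
    exact exists_momentControl_negBinomial hY _ q n_pos q_mem law inf_rate moment
  | gamma α α_pos τ lam lam_pos law inf_tau moment =>
    exact exists_momentControl_gamma hY α α_pos _ lam lam_pos law inf_tau moment
  | ghs α α_pos τ lam law inf_tau moment =>
    exact exists_momentControl_ghs hY _ α_pos _ lam law inf_tau moment

end GrandMeanURE

theorem theorem8 {Ω : Type*} [MeasurableSpace Ω] (P : Measure Ω) [IsProbabilityMeasure P]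
    (Y : ℕ → Ω → ℝ) (hY_meas : ∀ i, Measurable (Y i)) (hY_indep : iIndepFun Y P)
    (ν₀ ν₁ ν₂ : ℝ) (τ θ : ℕ → ℝ) (hY : GrandMeanURE.NEFQVFModel P Y ν₀ ν₁ ν₂ τ θ)
    -- `γPG p` is a minimizer of the unbiased risk estimate over `[0, ∞]`
    (γPG : ℕ → Ω → ℝ≥0∞) (hγPG_meas : ∀ p, Measurable (γPG p))
    (hγPG_min : ∀ p ω, ∀ g : ℝ≥0∞,
      GrandMeanURE.urePG ν₀ ν₁ ν₂ τ p (fun i => Y i ω) (γPG p ω) ≤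
        GrandMeanURE.urePG ν₀ ν₁ ν₂ τ p (fun i => Y i ω) g)
    -- `γ p` is an arbitrary nonnegative random variable
    (γ : ℕ → Ω → ℝ≥0∞) (hγ_meas : ∀ p, Measurable (γ p)) :
    -- the risks are finite
    (∀ p, Integrable (GrandMeanURE.grandMeanLoss Y τ θ p (γPG p)) P) ∧
    (∀ p, Integrable (GrandMeanURE.grandMeanLoss Y τ θ p (γ p)) P) ∧
    -- domination in loss
    (∀ ε : ℝ, 0 < ε →
      Tendsto (fun p : ℕ =>
        P {ω | GrandMeanURE.grandMeanLoss Y τ θ p (γPG p) ω ≥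
          GrandMeanURE.grandMeanLoss Y τ θ p (γ p) ω + ε}) atTop (𝓝 0)) ∧
    -- domination in risk
    limsup (fun p : ℕ =>
      ((GrandMeanURE.grandMeanRisk P Y τ θ p (γPG p) -
        GrandMeanURE.grandMeanRisk P Y τ θ p (γ p) : ℝ) : EReal)) atTop ≤ 0 := by
  obtain ⟨v, hv, hO⟩ := hY.exists_momentControl hY_meas
  obtain ⟨hloss, hrisk⟩ := hv.optimality hY_indep hO hγPG_meas hγPG_min hγ_meas
  exact ⟨fun p => hv.integrable_grandMeanLoss p (hγPG_meas p),
    fun p => hv.integrable_grandMeanLoss p (hγ_meas p), hloss, hrisk⟩
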